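/- Let $q\in\mathbb{C}^\times$ not be a root of unity (the generic case), with $\delta=q+q^{-1}$ real and $\delta\ge 0$. Let $TL_\infty=\bigcup_n TL_n(\delta)$ be the infinite Temperley--Lieb algebra, i.e. the unital complex algebra generated by $e_1,e_2,\dots$ subject to $e_i^2=\delta e_i$, $e_ie_{i\pm1}e_i=e_i$ and $e_ie_j=e_je_i$ for $|i-j|>1$, with the conjugate-linear anti-automorphism $*$ determined by $e_i^*=e_i$. A positive normalized trace on $TL_\infty$ is a linear functional $t$ with $t(1)=1$, $t(ab)=t(ba)$ for all $a,b$, and $t(aa^*)>0$ for all $a\neq0$; it is extremal if it is not a proper convex combination of other positive normalized traces. Let $0<\gamma\le\frac14$. (1) If $\delta>2$ (equivalently, $q$ is real), there is exactly one positive extremal trace $t$ on $TL_\infty$ with $t(e_1)=\delta\gamma$. (2) For every positive extremal trace $t$ on $TL_\infty$ with $t(e_1)=\delta\gamma$, let $\mathcal{H}_\gamma$ be the Hilbert space completion of $TL_\infty$ with respect to the inner product $\langle a,b\rangle=t(ab^*)$, and let $x\otimes y$ ($x,y\in TL_\infty$) act on $\mathcal{H}_\gamma$ by the bounded operator that extends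 $v\mapsto xvy^*$. Then this two-sided representation of $TL_\infty\otimes TL_\infty$ has no nontrivial closed invariant subspaces: every closed linear subspace $K\subseteq\mathcal{H}_\gamma$ that is mapped into itself by all $x\otimes y$ is $\{0\}$ or $\mathcal{H}_\gamma$. -/

import Mathlib

open scoped ComplexConjugate

noncomputable section

/-- The defining relations of the infinite Temperley-Lieb algebra. The generator with index
`i : ℕ` stands for `e_{i+1}`. -/
inductive TLRel (δ : ℝ) : FreeAlgebra ℂ ℕ → FreeAlgebra ℂ ℕ → Prop
  | sq (i : ℕ) : TLRel δ (FreeAlgebra.ι ℂ i * FreeAlgebra.ι ℂ i) ((δ : ℂ) • FreeAlgebra.ι ℂ i)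
  | up (i : ℕ) : TLRel δ
      (FreeAlgebra.ι ℂ i * FreeAlgebra.ι ℂ (i + 1) * FreeAlgebra.ι ℂ i) (FreeAlgebra.ι ℂ i)
  | down (i : ℕ) : TLRel δ
      (FreeAlgebra.ι ℂ (i + 1) * FreeAlgebra.ι ℂ i * FreeAlgebra.ι ℂ (i + 1))
      (FreeAlgebra.ι ℂ (i + 1))
  | comm (i j : ℕ) (h : i + 1 < j) : TLRel δ
      (FreeAlgebra.ι ℂ i * FreeAlgebra.ι ℂ j) (FreeAlgebra.ι ℂ j * FreeAlgebra.ι ℂ i)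

/-- The infinite Temperley-Lieb algebra `TL_∞(δ) = ⋃ₙ TL_n(δ)`: the unital complex algebra with
generators `e₁, e₂, …` and the Temperley-Lieb relations. -/
def TL (δ : ℝ) : Type := RingQuot (TLRel δ)

namespace TL

variable {δ : ℝ}

instance : Ring (TL δ) := inferInstanceAs (Ring (RingQuot (TLRel δ)))

instance : Algebra ℂ (TL δ) := inferInstanceAs (Algebra ℂ (RingQuot (TLRel δ)))

/-- The quotient map from the free algebra. -/
def mk (δ : ℝ) : FreeAlgebra ℂ ℕ →ₐ[ℂ] TL δ := RingQuot.mkAlgHom ℂ (TLRel δ)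

/-- The generators; `e i` is the generator usually written `e_{i+1}`. -/
def e (i : ℕ) : TL δ := mk δ (FreeAlgebra.ι ℂ i)

theorem mk_surjective : Function.Surjective (mk δ) := RingQuot.mkAlgHom_surjective ℂ (TLRel δ)

theorem mk_rel {x y : FreeAlgebra ℂ ℕ} (h : TLRel δ x y) : mk δ x = mk δ y :=
  RingQuot.mkAlgHom_rel ℂ h

theorem e_sq (i : ℕ) : (e i * e i : TL δ) = (δ : ℂ) • e i := by
  have h := mk_rel (TLRel.sq (δ := δ) i)
  rwa [map_mul, map_smul] at h

theorem e_up (i : ℕ) : (e i * e (i + 1) * e i : TL δ) = e i := by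
  simpa [e] using mk_rel (TLRel.up (δ := δ) i)

theorem e_down (i : ℕ) : (e (i + 1) * e i * e (i + 1) : TL δ) = e (i + 1) := by
  simpa [e] using mk_rel (TLRel.down (δ := δ) i)

theorem e_comm {i j : ℕ} (h : i + 1 < j) : (e i * e j : TL δ) = e j * e i := by
  simpa [e] using mk_rel (TLRel.comm (δ := δ) i j h)

theorem induction {p : TL δ → Prop} (hs : ∀ c : ℂ, p (algebraMap ℂ (TL δ) c))
    (he : ∀ i, p (e i)) (hm : ∀ a b, p a → p b → p (a * b))
    (ha : ∀ a b, p a → p b → p (a + b)) (a : TL δ) : p a := by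
  obtain ⟨x, rfl⟩ := mk_surjective a
  induction x with
  | grade0 c => simpa using hs c
  | grade1 i => exact he i
  | mul x y hx hy => simpa using hm _ _ hx hy
  | add x y hx hy => simpa using ha _ _ hx hy

/-- The opposite algebra of `TL δ` with complex conjugate scalar multiplication. -/
def ConjOp (δ : ℝ) : Type := (TL δ)ᵐᵒᵖ

instance : Ring (ConjOp δ) := inferInstanceAs (Ring (TL δ)ᵐᵒᵖ)

instance : Algebra ℂ (ConjOp δ) :=
  ((algebraMap ℂ (TL δ)ᵐᵒᵖ).comp (starRingEnd ℂ)).toAlgebra'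
    (fun c x => Algebra.commutes (A := (TL δ)ᵐᵒᵖ) (starRingEnd ℂ c) x)

theorem conjOp_algebraMap (c : ℂ) :
    algebraMap ℂ (ConjOp δ) c = MulOpposite.op (algebraMap ℂ (TL δ) (conj c)) := rfl

/-- The generators as elements of the conjugate opposite algebra. -/
def conjOpE (δ : ℝ) (i : ℕ) : ConjOp δ := MulOpposite.op (e i : TL δ)

/-- The homomorphism into the conjugate opposite algebra that fixes the generators. -/
def starHom (δ : ℝ) : TL δ →ₐ[ℂ] ConjOp δ :=
  RingQuot.liftAlgHom ℂ (s := TLRel δ)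
    ⟨FreeAlgebra.lift ℂ (conjOpE δ), by
      intro x y h
      cases h with
      | sq i =>
        rw [map_mul, map_smul, FreeAlgebra.lift_ι_apply, Algebra.smul_def, conjOp_algebraMap,
          Complex.conj_ofReal]
        change (MulOpposite.op (e i * e i) : (TL δ)ᵐᵒᵖ)
          = MulOpposite.op (e i * algebraMap ℂ (TL δ) δ)
        rw [e_sq, Algebra.smul_def, Algebra.commutes]
      | up i =>
        simp only [map_mul, FreeAlgebra.lift_ι_apply]
        change (MulOpposite.op (e i * (e (i + 1) * e i)) : (TL δ)ᵐᵒᵖ) = MulOpposite.op (e i)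
        rw [← mul_assoc, e_up]
      | down i =>
        simp only [map_mul, FreeAlgebra.lift_ι_apply]
        change (MulOpposite.op (e (i + 1) * (e i * e (i + 1))) : (TL δ)ᵐᵒᵖ)
          = MulOpposite.op (e (i + 1))
        rw [← mul_assoc, e_down]
      | comm i j h =>
        simp only [map_mul, FreeAlgebra.lift_ι_apply]
        change (MulOpposite.op (e j * e i) : (TL δ)ᵐᵒᵖ) = MulOpposite.op (e i * e j)
        rw [e_comm h]⟩

/-- The involution as a function. -/
def starFun (a : TL δ) : TL δ := MulOpposite.unop (α := TL δ) (starHom δ a)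

theorem starFun_mul (a b : TL δ) : starFun (a * b) = starFun b * starFun a := by
  unfold starFun
  rw [map_mul]
  rfl

theorem starFun_add (a b : TL δ) : starFun (a + b) = starFun a + starFun b := by
  unfold starFun
  rw [map_add]
  rfl

theorem starFun_algebraMap (c : ℂ) :
    starFun (algebraMap ℂ (TL δ) c) = algebraMap ℂ (TL δ) (conj c) := by
  unfold starFun
  rw [AlgHom.commutes]
  rfl

theorem starFun_e (i : ℕ) : starFun (e i : TL δ) = e i := by
  have h : starHom δ (e i) = conjOpE δ i := by
    refine (RingQuot.liftAlgHom_mkAlgHom_apply ℂ _ _ _).trans ?_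
    exact FreeAlgebra.lift_ι_apply _ _
  unfold starFun
  rw [h]
  rfl

theorem starFun_starFun (a : TL δ) : starFun (starFun a) = a := by
  induction a using TL.induction with
  | hs c => simp [starFun_algebraMap]
  | he i => simp [starFun_e]
  | hm a b ha hb => simp [starFun_mul, ha, hb]
  | ha a b ha hb => simp [starFun_add, ha, hb]

/-- The involution `*` of `TL_∞`: the conjugate linear anti-automorphism with `e_i* = e_i`. -/
instance : StarRing (TL δ) where
  star := starFun
  star_involutive := starFun_starFun
  star_mul := starFun_mul
  star_add := starFun_add

theorem star_e (i : ℕ) : star (e i : TL δ) = e i := starFun_e i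

theorem star_algebraMap (c : ℂ) :
    star (algebraMap ℂ (TL δ) c) = algebraMap ℂ (TL δ) (conj c) := starFun_algebraMap c

instance : StarModule ℂ (TL δ) where
  star_smul c a := by
    rw [Algebra.smul_def, star_mul, star_algebraMap, ← Algebra.commutes, ← Algebra.smul_def]
    rfl

/-- The positive normalized traces on `TL_∞`: linear functionals `t` with `t 1 = 1`,
`t (a b) = t (b a)`, and `t (a a*) > 0` for `a ≠ 0`. -/
def positiveTraces (δ : ℝ) : Set (TL δ →ₗ[ℂ] ℂ) :=
  {t | t 1 = 1 ∧ (∀ a b, t (a * b) = t (b * a)) ∧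
    ∀ a, a ≠ 0 → 0 < (t (a * star a)).re ∧ (t (a * star a)).im = 0}

/-- A positive normalized trace is extremal if it is not a convex combination of other
positive normalized traces. -/
def IsExtremal (t : positiveTraces δ) : Prop :=
  (t : TL δ →ₗ[ℂ] ℂ) ∈ Set.extremePoints ℝ (positiveTraces δ)

theorem trace_star (t : positiveTraces δ) (a : TL δ) : t.1 (star a) = conj (t.1 a) := by
  have him : ∀ b : TL δ, (t.1 (b * star b)).im = 0 := by
    intro b
    by_cases hb : b = 0
    · simp [hb]
    · exact (t.2.2.2 b hb).2
  have h1 := him (a + 1)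
  have h2 := him (Complex.I • a + 1)
  have h0 := him a
  have hone := t.2.1
  simp only [star_add, star_smul, star_one, add_mul, mul_add, mul_one, one_mul, map_add, hone,
    smul_mul_assoc, mul_smul_comm, map_smul, smul_eq_mul, Complex.add_im, Complex.one_im,
    Complex.mul_im, Complex.I_re, Complex.I_im, Complex.star_def, Complex.conj_I,
    Complex.neg_im, Complex.neg_re, Complex.mul_re, h0] at h1 h2
  apply Complex.ext
  · rw [Complex.conj_re]; linarith
  · rw [Complex.conj_im]; linarith

/-- The vector space `TL_∞` carrying the inner product of the trace `t`. -/
def Pre (_ : positiveTraces δ) : Type := TL δ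

variable (t : positiveTraces δ)

instance : AddCommGroup (Pre t) := inferInstanceAs (AddCommGroup (TL δ))

instance : Module ℂ (Pre t) := inferInstanceAs (Module ℂ (TL δ))

/-- The identity map from `TL_∞` to `Pre t`. -/
def toPre : TL δ ≃ₗ[ℂ] Pre t := LinearEquiv.refl ℂ (TL δ)

/-- The inner product `⟨a, b⟩ = t (a b*)`. Mathlib's inner products are conjugate linear in the
first variable, so `inner ℂ b a` is `t (a b*)`. -/
@[reducible]
def preCore : InnerProductSpace.Core ℂ (Pre t) where
  inner b a := t.1 ((toPre t).symm a * star ((toPre t).symm b))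
  conj_inner_symm x y := by
    rw [← trace_star, star_mul, star_star]
  re_inner_nonneg x := by
    by_cases hx : (toPre t).symm x = 0
    · simp [hx]
    · exact (t.2.2.2 _ hx).1.le
  add_left x y z := by
    rw [map_add, star_add, mul_add, map_add]
  smul_left x y r := by
    rw [map_smul, star_smul, mul_smul_comm, map_smul, smul_eq_mul]
    rfl
  definite x hx := by
    by_contra h
    have := (t.2.2.2 ((toPre t).symm x) (by simpa using h)).1
    rw [hx] at this
    simp at this

instance : NormedAddCommGroup (Pre t) := (preCore t).toNormedAddCommGroup

instance : InnerProductSpace ℂ (Pre t) := InnerProductSpace.ofCore (preCore t).toCore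

theorem inner_toPre (a b : TL δ) :
    (inner ℂ (toPre t b) (toPre t a) : ℂ) = t.1 (a * star b) := rfl

theorem norm_le_of_inner_eq {u v : Pre t}
    (h : (inner ℂ u u : ℂ) = (δ : ℂ) * inner ℂ v u) : ‖u‖ ≤ |δ| * ‖v‖ := by
  have h1 : ‖u‖ * ‖u‖ ≤ |δ| * ‖v‖ * ‖u‖ := by
    calc ‖u‖ * ‖u‖ = ‖(inner ℂ u u : ℂ)‖ := by
          rw [inner_self_eq_norm_sq_to_K]; simp [sq]
      _ = |δ| * ‖(inner ℂ v u : ℂ)‖ := by rw [h, norm_mul]; simp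
      _ ≤ |δ| * (‖v‖ * ‖u‖) := by gcongr; exact norm_inner_le_norm _ _
      _ = |δ| * ‖v‖ * ‖u‖ := by ring
  rcases (norm_nonneg u).eq_or_lt with h0 | h0
  · rw [← h0]; positivity
  · exact le_of_mul_le_mul_right h1 h0

theorem exists_bound_left (x : TL δ) :
    ∃ C : ℝ, 0 ≤ C ∧ ∀ a : TL δ, ‖toPre t (x * a)‖ ≤ C * ‖toPre t a‖ := by
  induction x using TL.induction with
  | hs c =>
    refine ⟨‖c‖, norm_nonneg c, fun a => ?_⟩
    rw [← Algebra.smul_def, map_smul, norm_smul]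
  | he i =>
    refine ⟨|δ|, abs_nonneg δ, fun a => norm_le_of_inner_eq t ?_⟩
    rw [inner_toPre, inner_toPre, star_mul, star_e]
    calc t.1 (e i * a * (star a * e i)) = t.1 (star a * e i * (e i * a)) := t.2.2.1 _ _
      _ = t.1 (star a * (e i * e i) * a) := by simp only [mul_assoc]
      _ = (δ : ℂ) * t.1 (star a * (e i * a)) := by
        rw [e_sq, mul_smul_comm, smul_mul_assoc, map_smul, smul_eq_mul, mul_assoc]
      _ = (δ : ℂ) * t.1 (e i * a * star a) := by rw [t.2.2.1 (star a)]
  | hm x y hx hy =>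
    obtain ⟨C, hC, hx⟩ := hx
    obtain ⟨D, hD, hy⟩ := hy
    refine ⟨C * D, mul_nonneg hC hD, fun a => ?_⟩
    rw [mul_assoc, mul_assoc]
    exact (hx _).trans (mul_le_mul_of_nonneg_left (hy a) hC)
  | ha x y hx hy =>
    obtain ⟨C, hC, hx⟩ := hx
    obtain ⟨D, hD, hy⟩ := hy
    refine ⟨C + D, add_nonneg hC hD, fun a => ?_⟩
    rw [add_mul, map_add, add_mul]
    exact (norm_add_le _ _).trans (add_le_add (hx a) (hy a))

theorem norm_toPre_star (a : TL δ) : ‖toPre t (star a)‖ = ‖toPre t a‖ := by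
  have h : (inner ℂ (toPre t (star a)) (toPre t (star a)) : ℂ)
      = inner ℂ (toPre t a) (toPre t a) := by
    rw [inner_toPre, inner_toPre, star_star, t.2.2.1]
  have h2 : ‖toPre t (star a)‖ ^ 2 = ‖toPre t a‖ ^ 2 := by
    rw [← inner_self_eq_norm_sq (𝕜 := ℂ), ← inner_self_eq_norm_sq (𝕜 := ℂ), h]
  exact (sq_eq_sq₀ (norm_nonneg _) (norm_nonneg _)).1 h2

theorem exists_bound (x y : TL δ) :
    ∃ C : ℝ, ∀ a : TL δ, ‖toPre t (x * a * star y)‖ ≤ C * ‖toPre t a‖ := by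
  obtain ⟨C, hC, hx⟩ := exists_bound_left t x
  obtain ⟨D, hD, hy⟩ := exists_bound_left t y
  refine ⟨C * D, fun a => ?_⟩
  rw [mul_assoc, mul_assoc]
  refine (hx _).trans (mul_le_mul_of_nonneg_left ?_ hC)
  rw [← norm_toPre_star, star_mul, star_star, ← norm_toPre_star t a]
  exact hy _

/-- The operator `a ↦ x a y*` on `TL_∞`, as a bounded operator for the norm of `t`. -/
def preAct (x y : TL δ) : Pre t →L[ℂ] Pre t :=
  LinearMap.mkContinuousOfExistsBound
    ((toPre t).toLinearMap ∘ₗ LinearMap.mulRight ℂ (star y) ∘ₗ LinearMap.mulLeft ℂ x ∘ₗ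
      (toPre t).symm.toLinearMap)
    (by
      obtain ⟨C, h⟩ := exists_bound t x y
      exact ⟨C, fun a => h ((toPre t).symm a)⟩)

/-- The Hilbert space completion `H_γ` of `TL_∞` for the inner product `⟨a, b⟩ = t (a b*)`. -/
abbrev TraceHilbert : Type := UniformSpace.Completion (Pre t)

/-- The inclusion of `TL_∞` in the Hilbert space. -/
def toHilbert (a : TL δ) : TraceHilbert t := (toPre t a : TraceHilbert t)

/-- The action of `x ⊗ y` on the Hilbert space: the continuous extension of `a ↦ x a y*`. -/
def act (x y : TL δ) : TraceHilbert t →L[ℂ] TraceHilbert t := (preAct t x y).completion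

theorem act_toHilbert (x y a : TL δ) :
    act t x y (toHilbert t a) = toHilbert t (x * a * star y) :=
  ContinuousLinearMap.completion_apply_coe _ _

theorem denseRange_toHilbert : DenseRange (toHilbert t) :=
  UniformSpace.Completion.denseRange_coe (α := Pre t)

/-- `act` respects products: `(x ⊗ y) (x' ⊗ y') = x x' ⊗ y y'`. -/
theorem act_mul (x y x' y' : TL δ) : act t (x * x') (y * y') = (act t x y).comp (act t x' y') := by
  refine ContinuousLinearMap.coeFn_injective ?_
  refine (denseRange_toHilbert t).equalizer (act t _ _).continuous
    ((act t x y).comp (act t x' y')).continuous (funext fun a => ?_)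
  simp only [Function.comp_apply, ContinuousLinearMap.comp_apply, act_toHilbert, star_mul,
    mul_assoc]

theorem inner_toHilbert (a b : TL δ) :
    (inner ℂ (toHilbert t b) (toHilbert t a) : ℂ) = t.1 (a * star b) :=
  UniformSpace.Completion.inner_coe _ _

/-- The two-sided action on the Hilbert space has no closed invariant subspaces other than
`0` and the whole space. -/
def NoClosedInvariantSubspace : Prop :=
  ∀ K : Submodule ℂ (TraceHilbert t), IsClosed (K : Set (TraceHilbert t)) →
    (∀ x y : TL δ, ∀ v ∈ K, act t x y v ∈ K) → K = ⊥ ∨ K = ⊤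

end TL

end

open Filter

namespace TL

variable {δ : ℝ}

/-! Both claims rest on the Radon–Nikodym form of extremality, `IsExtremal.eq_smul_of_le`: a tracial
functional squeezed between 0 and a multiple of an extremal `t` is a multiple of `t`. For
irreducibility, let `P` be the projection onto a closed invariant subspace. It commutes with the
left and right actions, so `a ↦ ⟨Pa, 1⟩` is a trace dominated by `t`. Hence `P` is a scalar, that
is, 0 or 1.

For the classification, the functional `x ↦ lim t(x eₘ)` is again a dominated trace, so an extremal
`t` satisfies `t(x eₘ) = τ t(x)` for `m` far from `x`. This Markov-type property, together with `e n
* a * e n = y * e n`, computes the trace recursively, which gives uniqueness. Conversely, a law of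
large numbers shows that a strictly positive trace with this property is extremal: the deviations
`eₘ - τ` at distant sites are orthogonal, while every trace takes the same value on each of them.

Existence comes from the spin chain. The generators conserve particle number, so the product state
with weight `κ` per particle restricts to a trace, with `τ = δκ/(1+κ)²`. Solving `κ/(1+κ)² = γ` is
possible exactly because `0 < γ ≤ 1/4`. Strict positivity follows from Jones–Wenzl idempotents,
which exist at all levels when `δ > 2`. -/

/-! ### Extremality and domination. -/

/-- A positive tracial functional dominated by a multiple of an extremal trace is proportional
to it. -/
theorem IsExtremal.eq_smul_of_le {t : positiveTraces δ} (ht : IsExtremal t) (s : TL δ →ₗ[ℂ] ℂ)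
    (hs : ∀ a b, s (a * b) = s (b * a)) (C : ℝ)
    (hC : ∀ a, ∃ r : ℝ, s (a * star a) = r ∧ 0 ≤ r ∧ r ≤ C * (t.1 (a * star a)).re) (a : TL δ) :
    s a = s 1 * t.1 a := by
  obtain ⟨r₁, h1, hr0, hr1⟩ := hC 1
  have ht1 := t.2.1
  simp only [star_one, mul_one, ht1, Complex.one_re] at h1 hr1
  have hCpos : 0 ≤ C := hr0.trans hr1
  -- Any `ε` with `ε * C < 1` keeps both `t ± ε(s - s(1)t)` strictly positive. The `+ 1` covers `C =
  -- 0`.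
  set ε : ℝ := 1 / (2 * (C + 1)) with hε
  have hεpos : 0 < ε := by positivity
  have hεC : ε * C < 1 := by
    rw [hε, one_div_mul_eq_div, div_lt_one (by positivity)]; linarith
  have hmem : ∀ σ : ℝ, (σ = ε ∨ σ = -ε) →
      t.1 + (σ : ℂ) • (s - (r₁ : ℂ) • t.1) ∈ positiveTraces δ := by
    intro σ hσ
    refine ⟨by simp [h1, ht1], fun a b => by simp [hs a b, t.2.2.1 a b], fun b hb => ?_⟩
    obtain ⟨r, h, h0, h2⟩ := hC b
    obtain ⟨hp, him⟩ := t.2.2.2 b hb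
    have key : (t.1 + (σ : ℂ) • (s - (r₁ : ℂ) • t.1)) (b * star b)
        = (((t.1 (b * star b)).re + σ * (r - r₁ * (t.1 (b * star b)).re) : ℝ) : ℂ) := by
      have : t.1 (b * star b) = ((t.1 (b * star b)).re : ℂ) := by
        apply Complex.ext <;> simp [him]
      simp only [LinearMap.add_apply, LinearMap.smul_apply, LinearMap.sub_apply, smul_eq_mul, h]
      rw [this]
      push_cast
      simp
    rw [key]
    refine ⟨?_, Complex.ofReal_im _⟩
    rw [Complex.ofReal_re]
    set T := (t.1 (b * star b)).re
    rcases hσ with rfl | rfl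
    · have : ε * r₁ < 1 := by nlinarith
      nlinarith [mul_nonneg hεpos.le h0, mul_pos (sub_pos.2 this) hp]
    · have : ε * r ≤ ε * (C * T) := mul_le_mul_of_nonneg_left h2 hεpos.le
      nlinarith [mul_pos (sub_pos.2 hεC) hp, mul_nonneg (mul_nonneg hεpos.le hr0) hp.le]
  -- `t` is the midpoint of the two perturbations, so extremality makes the perturbation vanish.
  have heq := ht.2 (hmem ε (Or.inl rfl)) (hmem (-ε) (Or.inr rfl))
    ⟨1 / 2, 1 / 2, by norm_num, by norm_num, by norm_num, by
      ext x
      simp only [LinearMap.add_apply, LinearMap.smul_apply, LinearMap.sub_apply, smul_eq_mul,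
        Complex.real_smul]
      push_cast
      ring⟩
  have h3 := congrArg (fun f : TL δ →ₗ[ℂ] ℂ => f a) heq
  simp only [LinearMap.add_apply, LinearMap.smul_apply, LinearMap.sub_apply, smul_eq_mul,
    add_eq_left, mul_eq_zero, Complex.ofReal_eq_zero, hεpos.ne', false_or] at h3
  rw [h1, sub_eq_zero.1 h3]

/-! ### Irreducibility of the two-sided representation. -/

section Hilbert

variable (t : positiveTraces δ)

/-- The inclusion of `TL_∞` in its Hilbert space completion as a linear map. -/
noncomputable def toHilbertₗ : TL δ →ₗ[ℂ] TraceHilbert t :=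
  (UniformSpace.Completion.toComplL (𝕜 := ℂ) (E := Pre t)).toLinearMap ∘ₗ (toPre t).toLinearMap

theorem inner_act (x y : TL δ) (v w : TraceHilbert t) :
    (inner ℂ (act t x y v) w : ℂ) = inner ℂ v (act t (star x) (star y) w) := by
  refine (denseRange_toHilbert t).induction_on₂
    (p := fun v w => (inner ℂ (act t x y v) w : ℂ) = inner ℂ v (act t (star x) (star y) w))
    (isClosed_eq ?_ ?_) (fun a b => ?_) v w
  · fun_prop
  · fun_prop
  · rw [act_toHilbert, act_toHilbert, inner_toHilbert, inner_toHilbert, star_mul, star_mul,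
      star_star, t.2.2.1 (star x * b * y), ← mul_assoc, ← mul_assoc, t.2.2.1]
    simp only [mul_assoc]
    rw [t.2.2.1 (star a)]
    simp only [mul_assoc]

/-- The two-sided representation of an extremal trace is irreducible. -/
theorem IsExtremal.noClosedInvariantSubspace {t : positiveTraces δ} (ht : IsExtremal t) :
    NoClosedInvariantSubspace t := by
  intro K hK hinv
  have : CompleteSpace K := hK.completeSpace_coe
  have hperp : ∀ x y : TL δ, ∀ v ∈ Kᗮ, act t x y v ∈ Kᗮ := by
    intro x y v hv
    rw [Submodule.mem_orthogonal] at hv ⊢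
    intro u hu
    have := inner_act t (star x) (star y) u v
    rw [star_star, star_star] at this
    rw [← this]
    exact hv _ (hinv _ _ _ hu)
  have hcomm : ∀ (x y : TL δ) (v : TraceHilbert t),
      K.starProjection (act t x y v) = act t x y (K.starProjection v) := by
    intro x y v
    refine (Submodule.eq_starProjection_of_mem_orthogonal
      (hinv x y _ (K.starProjection_apply_mem v)) ?_)
    rw [← map_sub]
    exact hperp _ _ _ (K.sub_starProjection_mem_orthogonal v)
  let s : TL δ →ₗ[ℂ] ℂ :=
    (innerSL ℂ (toHilbert t 1)).toLinearMap ∘ₗ K.starProjection.toLinearMap ∘ₗ toHilbertₗ t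
  have hsapp : ∀ a, s a = inner ℂ (toHilbert t 1) (K.starProjection (toHilbert t a)) :=
    fun a => rfl
  -- Commuting the projection past the right action gives `hR`, past the left action `hL`. The
  -- right-hand sides agree, and this is the trace property of `s`.
  have hR : ∀ a b, s (a * star b) = inner ℂ (toHilbert t b) (K.starProjection (toHilbert t a)) := by
    intro a b
    have h1 : toHilbert t (a * star b) = act t 1 b (toHilbert t a) := by
      rw [act_toHilbert, one_mul]
    have h2 : toHilbert t b = act t 1 (star b) (toHilbert t 1) := by
      rw [act_toHilbert, one_mul, one_mul, star_star]
    rw [hsapp, h1, hcomm, h2, inner_act, star_one, star_star]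
  have hL : ∀ a b, s (star b * a) = inner ℂ (toHilbert t b) (K.starProjection (toHilbert t a)) := by
    intro a b
    have h1 : toHilbert t (star b * a) = act t (star b) 1 (toHilbert t a) := by
      rw [act_toHilbert, star_one, mul_one]
    have h2 : toHilbert t b = act t b 1 (toHilbert t 1) := by
      rw [act_toHilbert, star_one, mul_one, mul_one]
    rw [hsapp, h1, hcomm, h2, inner_act, star_one]
  have hs : ∀ a b, s (a * b) = s (b * a) := by
    intro a b
    have h1 := hR a (star b)
    have h2 := hL a (star b)
    rw [star_star] at h1 h2
    rw [h1, h2]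
  have hc := ht.eq_smul_of_le s hs 1 fun a => by
    refine ⟨‖K.starProjection (toHilbert t a)‖ ^ 2, ?_, by positivity, ?_⟩
    · have hPP : K.starProjection (K.starProjection (toHilbert t a))
          = K.starProjection (toHilbert t a) :=
        K.starProjection_eq_self_iff.2 (K.starProjection_apply_mem _)
      rw [hR, ← hPP, ← Submodule.inner_starProjection_left_eq_right, hPP,
        inner_self_eq_norm_sq_to_K]
      simp
    · rw [one_mul, ← inner_toHilbert, inner_self_eq_norm_sq_to_K]
      have h := K.norm_starProjection_apply_le (toHilbert t a)
      have h2 : ((‖toHilbert t a‖ : ℂ) ^ 2).re = ‖toHilbert t a‖ ^ 2 := by norm_cast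
      refine (pow_le_pow_left₀ (norm_nonneg _) h 2).trans h2.ge
  have hP : ∀ v, K.starProjection v = s 1 • v := by
    refine fun v => congrFun ((denseRange_toHilbert t).equalizer
      (K.starProjection.continuous) (continuous_const_smul (s 1)) (funext fun a => ?_)) v
    refine (denseRange_toHilbert t).eq_of_inner_right ℂ (fun b => ?_)
    rw [Function.comp_apply, Function.comp_apply, ← hR, hc, inner_smul_right, inner_toHilbert]
  by_cases h0 : s 1 = 0
  · left
    rw [Submodule.eq_bot_iff]
    intro v hv
    rw [← K.starProjection_eq_self_iff.2 hv, hP, h0, zero_smul]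
  · right
    rw [Submodule.eq_top_iff']
    intro v
    have h := K.starProjection_apply_mem v
    rw [hP] at h
    exact (K.smul_mem_iff h0).1 h

end Hilbert

/-! ### Structure of the finite Temperley–Lieb algebras. -/

/-- The subalgebra generated by the first `n` generators. -/
def initial (δ : ℝ) (n : ℕ) : Subalgebra ℂ (TL δ) :=
  Algebra.adjoin ℂ {x | ∃ i < n, x = e i}

theorem e_mem_initial {i n : ℕ} (h : i < n) : (e i : TL δ) ∈ initial δ n :=
  Algebra.subset_adjoin ⟨i, h, rfl⟩

theorem initial_mono {m n : ℕ} (h : m ≤ n) : initial δ m ≤ initial δ n :=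
  Algebra.adjoin_mono fun _ ⟨i, hi, hx⟩ => ⟨i, hi.trans_le h, hx⟩

theorem initial_zero : initial δ 0 = ⊥ := by
  simp [initial]

theorem exists_mem_initial (x : TL δ) : ∃ n, x ∈ initial δ n := by
  induction x using TL.induction with
  | hs c => exact ⟨0, (initial δ 0).algebraMap_mem c⟩
  | he i => exact ⟨i + 1, e_mem_initial i.lt_succ_self⟩
  | hm a b ha hb =>
    obtain ⟨m, ha⟩ := ha
    obtain ⟨n, hb⟩ := hb
    exact ⟨max m n, mul_mem (initial_mono (le_max_left _ _) ha)
      (initial_mono (le_max_right _ _) hb)⟩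
  | ha a b ha hb =>
    obtain ⟨m, ha⟩ := ha
    obtain ⟨n, hb⟩ := hb
    exact ⟨max m n, add_mem (initial_mono (le_max_left _ _) ha)
      (initial_mono (le_max_right _ _) hb)⟩

theorem commute_e {i j : ℕ} (h : i + 1 < j) : Commute (e i : TL δ) (e j) := e_comm h

/-- The alternative `n = 0` is the case of scalars, which commute even with `e 0`. -/
theorem commute_of_mem_initial {n m : ℕ} (h : n < m ∨ n = 0) {x : TL δ} (hx : x ∈ initial δ n) :
    Commute x (e m) := by
  induction hx using Algebra.adjoin_induction with
  | mem x hx =>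
    obtain ⟨i, hi, rfl⟩ := hx
    exact commute_e (by omega)
  | algebraMap r => exact Algebra.commute_algebraMap_left r _
  | add x y _ _ hx hy => exact hx.add_left hy
  | mul x y _ _ hx hy => exact hx.mul_left hy

/-- The span of the products `a eₙ b` with `a`, `b` in the algebra of the first `n` generators. -/
def middle (δ : ℝ) (n : ℕ) : Submodule ℂ (TL δ) :=
  Submodule.span ℂ {x | ∃ a ∈ initial δ n, ∃ b ∈ initial δ n, x = a * e n * b}

theorem mem_middle {n : ℕ} {a b : TL δ} (ha : a ∈ initial δ n) (hb : b ∈ initial δ n) :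
    a * e n * b ∈ middle δ n :=
  Submodule.subset_span ⟨a, ha, b, hb, rfl⟩

theorem mul_mem_middle {n : ℕ} {a x : TL δ} (ha : a ∈ initial δ n) (hx : x ∈ middle δ n) :
    a * x ∈ middle δ n := by
  induction hx using Submodule.span_induction with
  | mem x hx =>
    obtain ⟨b, hb, c, hc, rfl⟩ := hx
    rw [← mul_assoc, ← mul_assoc]
    exact mem_middle (mul_mem ha hb) hc
  | zero => rw [mul_zero]; exact zero_mem _
  | add x y _ _ hx hy => rw [mul_add]; exact add_mem hx hy
  | smul c x _ hx => rw [mul_smul_comm]; exact Submodule.smul_mem _ _ hx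

/-- A word needs `e n` at most once, since two occurrences merge by `hE`. The property `hE` is a
hypothesis because it is proved by an induction that uses this lemma at the previous level. -/
theorem mem_initial_succ_aux {n : ℕ}
    (hE : ∀ a ∈ initial δ n, ∃ y ∈ initial δ (n - 1), (e n * a * e n : TL δ) = y * e n)
    {x : TL δ} (hx : x ∈ initial δ (n + 1)) :
    x ∈ Subalgebra.toSubmodule (initial δ n) ⊔ middle δ n := by
  set M := Subalgebra.toSubmodule (initial δ n) ⊔ middle δ n
  have hM1 : ∀ a ∈ initial δ n, a ∈ M := fun a ha => Submodule.mem_sup_left ha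
  -- It suffices that `M`, which contains 1, is stable under left multiplication by the generators.
  suffices h : ∀ z ∈ M, x * z ∈ M by
    simpa using h 1 (hM1 1 (one_mem _))
  induction hx using Algebra.adjoin_induction with
  | mem x hx =>
    obtain ⟨i, hi, rfl⟩ := hx
    intro z hz
    obtain ⟨a, ha, b, hb, rfl⟩ := Submodule.mem_sup.1 hz
    rw [mul_add]
    rcases Nat.lt_succ_iff_lt_or_eq.1 hi with hi | rfl
    · exact add_mem (hM1 _ (mul_mem (e_mem_initial hi) ha))
        (Submodule.mem_sup_right (mul_mem_middle (e_mem_initial hi) hb))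
    · refine Submodule.mem_sup_right (add_mem ?_ ?_)
      · rw [← one_mul (e i)]
        exact mem_middle (one_mem _) ha
      · clear hz
        induction hb using Submodule.span_induction with
        | mem x hx =>
          obtain ⟨b, hb, c, hc, rfl⟩ := hx
          obtain ⟨y, hy, h⟩ := hE b hb
          rw [← mul_assoc, ← mul_assoc, h]
          exact mem_middle (initial_mono (Nat.sub_le _ _) hy) hc
        | zero => rw [mul_zero]; exact zero_mem _
        | add x y _ _ hx hy =>
          rw [mul_add]
          exact add_mem hx hy
        | smul c x _ hx =>
          rw [mul_smul_comm]
          exact Submodule.smul_mem _ _ hx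
  | algebraMap r =>
    intro z hz
    rw [← Algebra.smul_def]
    exact Submodule.smul_mem _ _ hz
  | add x y _ _ hx hy => exact fun z hz => by rw [add_mul]; exact add_mem (hx z hz) (hy z hz)
  | mul x y _ _ hx hy => exact fun z hz => by rw [mul_assoc]; exact hx _ (hy z hz)

/-- The conditional expectation property of the Temperley-Lieb algebras. -/
theorem exists_e_mul_mul_e (n : ℕ) :
    ∀ a ∈ initial δ n, ∃ y ∈ initial δ (n - 1), (e n * a * e n : TL δ) = y * e n := by
  have hcomm : ∀ n, ∀ a ∈ initial δ (n - 1),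
      ∃ y ∈ initial δ (n - 1), (e n * a * e n : TL δ) = y * e n := by
    intro n a ha
    refine ⟨(δ : ℂ) • a, Subalgebra.smul_mem _ ha _, ?_⟩
    rw [← (commute_of_mem_initial (by omega) ha).eq, mul_assoc, e_sq, mul_smul_comm,
      smul_mul_assoc]
  induction n with
  -- Here `0 - 1 = 0`, so this is the case where `a` is a scalar.
  | zero => exact hcomm 0
  | succ n ih =>
    intro a ha
    obtain ⟨b, hb, c, hc, rfl⟩ := Submodule.mem_sup.1 (mem_initial_succ_aux ih ha)
    suffices h : ∃ y ∈ initial δ n, (e (n + 1) * c * e (n + 1) : TL δ) = y * e (n + 1) by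
      obtain ⟨y, hy, h⟩ := h
      obtain ⟨z, hz, h'⟩ := hcomm (n + 1) b hb
      exact ⟨z + y, add_mem hz hy, by rw [mul_add, add_mul, h', h, add_mul]⟩
    clear ha
    induction hc using Submodule.span_induction with
    | mem x hx =>
      obtain ⟨u, hu, v, hv, rfl⟩ := hx
      refine ⟨u * v, mul_mem hu hv, ?_⟩
      have h1 := (commute_of_mem_initial (Or.inl n.lt_succ_self) hu).eq
      have h2 := (commute_of_mem_initial (Or.inl n.lt_succ_self) hv).eq
      calc (e (n + 1) * (u * e n * v) * e (n + 1) : TL δ)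
          = (e (n + 1) * u) * e n * (v * e (n + 1)) := by simp only [mul_assoc]
        _ = u * (e (n + 1) * e n * e (n + 1)) * v := by rw [← h1, h2]; simp only [mul_assoc]
        _ = u * v * e (n + 1) := by rw [e_down, mul_assoc, ← h2, mul_assoc]
    | zero => exact ⟨0, zero_mem _, by simp⟩
    | add x y _ _ hx hy =>
      obtain ⟨u, hu, hx⟩ := hx
      obtain ⟨v, hv, hy⟩ := hy
      exact ⟨u + v, add_mem hu hv, by rw [mul_add, add_mul, hx, hy, add_mul]⟩
    | smul c x _ hx =>
      obtain ⟨u, hu, hx⟩ := hx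
      exact ⟨c • u, Subalgebra.smul_mem _ hu _, by
        rw [mul_smul_comm, smul_mul_assoc, hx, smul_mul_assoc]⟩

theorem mem_initial_succ {n : ℕ} {x : TL δ} (hx : x ∈ initial δ (n + 1)) :
    x ∈ Subalgebra.toSubmodule (initial δ n) ⊔ middle δ n :=
  mem_initial_succ_aux (exists_e_mul_mul_e n) hx

/-! ### Product traces and their uniqueness. -/

/-- A tracial functional that is asymptotically multiplicative on generators. -/
structure IsProductTrace (t : TL δ →ₗ[ℂ] ℂ) (τ : ℂ) : Prop where
  comm : ∀ a b, t (a * b) = t (b * a)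
  eventually : ∀ x, ∀ᶠ m in atTop, t (x * e m) = τ * t x

/-- Up to the factor `δ`, `e m` and `e (m + 1)` are equivalent projections in the commutant of `x`.
Both sides equal `δ * t (x * e m * e (m + 1))`. -/
theorem trace_mul_e_succ {t : TL δ →ₗ[ℂ] ℂ} (ht : ∀ a b, t (a * b) = t (b * a)) {n m : ℕ}
    (h : n < m ∨ n = 0) {x : TL δ} (hx : x ∈ initial δ n) :
    t (x * e (m + 1)) = t (x * e m) := by
  have h0 := (commute_of_mem_initial h hx).eq
  have h1 := (commute_of_mem_initial (m := m + 1) (by omega) hx).eq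
  have h2 : t (x * e m) = δ * t (x * e m * e (m + 1)) := by
    calc t (x * e m) = t (x * (e m * e (m + 1) * e m)) := by rw [e_up]
      _ = t ((x * e m * e (m + 1)) * e m) := by simp only [mul_assoc]
      _ = t (x * (e m * e m) * e (m + 1)) := by
        rw [ht, ← mul_assoc, ← mul_assoc, ← h0]; simp only [mul_assoc]
      _ = _ := by rw [e_sq, mul_smul_comm, smul_mul_assoc, map_smul, smul_eq_mul]
  have h3 : t (x * e (m + 1)) = δ * t (x * e m * e (m + 1)) := by
    calc t (x * e (m + 1)) = t (x * (e (m + 1) * e m * e (m + 1))) := by rw [e_down]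
      _ = t ((e (m + 1) * x) * e m * e (m + 1)) := by rw [← h1]; simp only [mul_assoc]
      _ = t (x * e m * (e (m + 1) * e (m + 1))) := by
        rw [mul_assoc, mul_assoc, ht]; simp only [mul_assoc]
      _ = _ := by rw [e_sq, mul_smul_comm, map_smul, smul_eq_mul]
  rw [h2, h3]

theorem trace_mul_e_eq {t : TL δ →ₗ[ℂ] ℂ} (ht : ∀ a b, t (a * b) = t (b * a)) {n m : ℕ}
    (h : n < m ∨ n = 0) {x : TL δ} (hx : x ∈ initial δ n) {k : ℕ} (hk : m ≤ k) :
    t (x * e k) = t (x * e m) := by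
  induction k, hk using Nat.le_induction with
  | base => rfl
  | succ k hk ih => rw [trace_mul_e_succ ht (by omega) hx, ih]

theorem IsProductTrace.mul_e {t : TL δ →ₗ[ℂ] ℂ} {τ : ℂ} (ht : IsProductTrace t τ) {n m : ℕ}
    (h : n < m ∨ n = 0) {x : TL δ} (hx : x ∈ initial δ n) : t (x * e m) = τ * t x := by
  obtain ⟨k, hk, hmk⟩ := ((ht.eventually x).and (eventually_ge_atTop m)).exists
  rw [← hk, trace_mul_e_eq ht.comm h hx hmk]

theorem IsProductTrace.apply_e {t : TL δ →ₗ[ℂ] ℂ} {τ : ℂ} (ht : IsProductTrace t τ) (m : ℕ) :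
    t (e m) = τ * t 1 := by
  rw [← one_mul (e m), ht.mul_e (Or.inr rfl) (one_mem (initial δ 0))]

/-- A product trace is determined by its values at `1` and at a generator. -/
theorem IsProductTrace.eq {s t : TL δ →ₗ[ℂ] ℂ} {τ : ℂ} (hδ : δ ≠ 0) (hs : IsProductTrace s τ)
    (ht : IsProductTrace t τ) (h1 : s 1 = t 1) : s = t := by
  have key : ∀ n, (∀ x ∈ initial δ n, s x = t x) := by
    intro n
    induction n with
    | zero =>
      intro x hx
      rw [initial_zero, Algebra.mem_bot] at hx
      obtain ⟨c, rfl⟩ := hx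
      rw [Algebra.algebraMap_eq_smul_one, map_smul, map_smul, h1]
    | succ n ih =>
      -- `δ r(c eₙ) = r(c eₙ eₙ) = r(eₙ c eₙ) = r(y eₙ) = τ r(y)`, so values at the new level reduce
      -- to values at the old one.
      have hr : ∀ {r : TL δ →ₗ[ℂ] ℂ}, IsProductTrace r τ → ∀ c ∈ initial δ n, ∀ y ∈ initial δ (n - 1),
          (e n * c * e n : TL δ) = y * e n → (δ : ℂ) * r (c * e n) = τ * r y := by
        intro r hr c hc y hy h
        rw [← hr.mul_e (m := n) (by omega) hy, ← h, mul_assoc, hr.comm (e n), mul_assoc, e_sq, mul_smul_comm,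
          map_smul, smul_eq_mul]
      intro x hx
      obtain ⟨a, ha, b, hb, rfl⟩ := Submodule.mem_sup.1 (mem_initial_succ hx)
      rw [map_add, map_add, ih a ha]
      congr 1
      clear hx
      induction hb using Submodule.span_induction with
      | mem x hx =>
        obtain ⟨u, hu, v, hv, rfl⟩ := hx
        obtain ⟨y, hy, h⟩ := exists_e_mul_mul_e n (v * u) (mul_mem hv hu)
        rw [hs.comm, ht.comm, ← mul_assoc]
        have h3 := hr hs _ (mul_mem hv hu) y hy h
        have h4 := hr ht _ (mul_mem hv hu) y hy h
        rw [ih y (initial_mono (Nat.sub_le _ _) hy), ← h4] at h3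
        exact mul_left_cancel₀ (by exact_mod_cast hδ) h3
      | zero => simp
      | add x y _ _ hx hy => rw [map_add, map_add, hx, hy]
      | smul c x _ hx => rw [map_smul, map_smul, hx]
  ext x
  obtain ⟨n, hn⟩ := exists_mem_initial x
  exact key n x hn

/-! ### Extremal traces are product traces. -/

/-- An eventually constant sequence of functionals has a linear limit. -/
theorem exists_linearMap_eventually_eq {V : Type*} [AddCommGroup V] [Module ℂ V]
    (F : ℕ → V →ₗ[ℂ] ℂ) (hF : ∀ x, ∃ c, ∀ᶠ n in atTop, F n x = c) :
    ∃ L : V →ₗ[ℂ] ℂ, ∀ x, ∀ᶠ n in atTop, F n x = L x := by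
  choose L hL using hF
  refine ⟨⟨⟨L, fun x y => ?_⟩, fun c x => ?_⟩, hL⟩
  · obtain ⟨n, h1, h2, h3⟩ := ((hL x).and ((hL y).and (hL (x + y)))).exists
    rw [← h1, ← h2, ← h3, map_add]
  · obtain ⟨n, h1, h2⟩ := ((hL x).and (hL (c • x))).exists
    change L (c • x) = c • L x
    rw [← h1, ← h2, map_smul]

theorem eventually_commute_e (x : TL δ) : ∀ᶠ m in atTop, Commute x (e m) := by
  obtain ⟨n, hn⟩ := exists_mem_initial x
  filter_upwards [eventually_gt_atTop n] with m hm
  exact commute_of_mem_initial (Or.inl hm) hn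

theorem exists_limit_mul_e {t : TL δ →ₗ[ℂ] ℂ} (ht : ∀ a b, t (a * b) = t (b * a)) :
    ∃ L : TL δ →ₗ[ℂ] ℂ, ∀ x, ∀ᶠ m in atTop, t (x * e m) = L x := by
  refine exists_linearMap_eventually_eq (fun m => t ∘ₗ LinearMap.mulRight ℂ (e m)) fun x => ?_
  obtain ⟨n, hn⟩ := exists_mem_initial x
  refine ⟨t (x * e (n + 1)), ?_⟩
  filter_upwards [eventually_ge_atTop (n + 1)] with m hm
  exact trace_mul_e_eq ht (Or.inl n.lt_succ_self) hn hm

/-- A trace on `TL_∞` that is positive but not necessarily strictly positive. -/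
structure IsNonnegTrace (t : TL δ →ₗ[ℂ] ℂ) : Prop where
  comm : ∀ a b, t (a * b) = t (b * a)
  nonneg : ∀ a, ∃ r : ℝ, t (a * star a) = r ∧ 0 ≤ r

theorem isNonnegTrace (t : positiveTraces δ) : IsNonnegTrace t.1 := by
  refine ⟨t.2.2.1, fun a => ⟨(t.1 (a * star a)).re, ?_, ?_⟩⟩
  · apply Complex.ext
    · simp
    · by_cases ha : a = 0
      · simp [ha]
      · simpa using (t.2.2.2 a ha).2
  · by_cases ha : a = 0
    · simp [ha]
    · exact (t.2.2.2 a ha).1.le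

/-- Asymptotic multiplicativity of extremal traces. -/
theorem IsExtremal.isProductTrace (hδ : 0 < δ) {t : positiveTraces δ} (ht : IsExtremal t) :
    IsProductTrace t.1 (t.1 (e 0)) := by
  refine ⟨t.2.2.1, ?_⟩
  obtain ⟨L, hL⟩ := exists_limit_mul_e t.2.2.1
  have hL1 : L 1 = t.1 (e 0) := by
    obtain ⟨m, hm⟩ := (hL 1).exists
    rw [← hm, trace_mul_e_eq t.2.2.1 (Or.inr rfl) (one_mem (initial δ 0)) (Nat.zero_le m), one_mul]
  suffices h : ∀ x, L x = L 1 * t.1 x by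
    intro x
    filter_upwards [hL x] with m hm
    rw [hm, h, hL1]
  refine ht.eq_smul_of_le L ?_ δ ?_
  · intro a b
    obtain ⟨m, h1, h2, h3, h4⟩ := ((hL (a * b)).and ((hL (b * a)).and
      ((eventually_commute_e a).and (eventually_commute_e b)))).exists
    rw [← h1, ← h2, mul_assoc, t.2.2.1, mul_assoc, ← h3.eq, mul_assoc]
  · intro a
    obtain ⟨m, hm, hc, hc'⟩ := ((hL (a * star a)).and ((eventually_commute_e a).and
      (eventually_commute_e (star a)))).exists
    obtain ⟨u, hu, hu0⟩ := (isNonnegTrace t).nonneg (a * e m)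
    -- As `e m / δ` is a projection, positivity on `a * e m` gives `0 ≤ L(aa*)`, and positivity on
    -- the complementary part gives `L(aa*) ≤ δ t(aa*)`.
    obtain ⟨v, hv, hv0⟩ := (isNonnegTrace t).nonneg ((δ : ℂ) • a - a * e m)
    obtain ⟨w, hw, hw0⟩ := (isNonnegTrace t).nonneg a
    have hsq : a * e m * (e m * star a) = (δ : ℂ) • (a * star a * e m) := by
      calc a * e m * (e m * star a) = a * (e m * e m) * star a := by simp only [mul_assoc]
        _ = (δ : ℂ) • (a * (e m * star a)) := by
          rw [e_sq, mul_smul_comm, smul_mul_assoc, mul_assoc]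
        _ = _ := by rw [← hc'.eq, mul_assoc]
    have hae : a * (e m * star a) = a * star a * e m := by rw [← hc'.eq, mul_assoc]
    rw [star_mul, star_e, hsq, map_smul, hm, smul_eq_mul] at hu
    have hL' : L (a * star a) = ((u / δ : ℝ) : ℂ) := by
      rw [Complex.ofReal_div, eq_div_iff (by exact_mod_cast hδ.ne'), mul_comm, hu]
    refine ⟨u / δ, hL', by positivity, ?_⟩
    rw [hw, Complex.ofReal_re]
    have hv' : (v : ℂ) = ((δ ^ 2 * w - u : ℝ) : ℂ) := by
      rw [← hv, star_sub, star_mul, star_e, star_smul]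
      simp only [sub_mul, mul_sub, smul_mul_assoc, mul_smul_comm, map_sub, map_smul, hsq,
        smul_eq_mul, hw, hm]
      rw [mul_assoc a (e m), hae, hm, hL']
      simp only [Complex.star_def, Complex.conj_ofReal, Complex.ofReal_div, Complex.ofReal_sub,
        Complex.ofReal_mul, Complex.ofReal_pow]
      have : (δ : ℂ) ≠ 0 := by exact_mod_cast hδ.ne'
      field_simp
      ring
    have hv2 : v = δ ^ 2 * w - u := by exact_mod_cast hv'
    rw [div_le_iff₀ hδ]
    nlinarith

/-! ### Product traces are extremal. -/

theorem IsNonnegTrace.apply_star {s : TL δ →ₗ[ℂ] ℂ} (hs : IsNonnegTrace s) (a : TL δ) :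
    s (star a) = conj (s a) := by
  have him : ∀ b : TL δ, (s (b * star b)).im = 0 := by
    intro b
    obtain ⟨r, hr, -⟩ := hs.nonneg b
    rw [hr, Complex.ofReal_im]
  -- Polarization: reality at `a + 1` and at `ia + 1` yields the imaginary and real parts of the
  -- claim.
  have h1 := him (a + 1)
  have h2 := him (Complex.I • a + 1)
  have h0 := him a
  have hone := him 1
  simp only [star_add, star_smul, star_one, add_mul, mul_add, mul_one, one_mul, map_add,
    smul_mul_assoc, mul_smul_comm, map_smul, smul_eq_mul, Complex.add_im,
    Complex.mul_im, Complex.I_re, Complex.I_im, Complex.star_def, Complex.conj_I,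
    Complex.neg_im, Complex.neg_re, Complex.mul_re, h0] at h1 h2 hone
  apply Complex.ext
  · rw [Complex.conj_re]; linarith
  · rw [Complex.conj_im]; linarith

/-- The positive semidefinite form `⟨a, b⟩ = s (a b*)`. -/
@[reducible]
noncomputable def IsNonnegTrace.core {s : TL δ →ₗ[ℂ] ℂ} (hs : IsNonnegTrace s) :
    PreInnerProductSpace.Core ℂ (TL δ) where
  inner b a := s (a * star b)
  conj_inner_symm x y := by rw [← hs.apply_star, star_mul, star_star]
  re_inner_nonneg x := by
    obtain ⟨r, hr, h⟩ := hs.nonneg x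
    rw [hr]
    exact h
  add_left x y z := by rw [star_add, mul_add, map_add]
  smul_left x y r := by
    rw [star_smul, mul_smul_comm, map_smul, smul_eq_mul]
    rfl

theorem IsNonnegTrace.cauchySchwarz {s : TL δ →ₗ[ℂ] ℂ} (hs : IsNonnegTrace s) (a b : TL δ) :
    ‖s (a * star b)‖ ^ 2 ≤ (s (a * star a)).re * (s (b * star b)).re := by
  have h := @InnerProductSpace.Core.inner_mul_inner_self_le ℂ (TL δ) _ _ _ hs.core a b
  have h2 : ‖s (b * star a)‖ = ‖s (a * star b)‖ := by
    rw [← Complex.norm_conj, ← hs.apply_star, star_mul, star_star]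
  change ‖s (b * star a)‖ * ‖s (a * star b)‖ ≤ _ at h
  rw [h2, ← sq] at h
  exact h

/-- A strictly positive product trace is extremal. -/
theorem IsProductTrace.isExtremal (hδ : 0 < δ) {t : positiveTraces δ} {τ : ℂ}
    (ht : IsProductTrace t.1 τ) : IsExtremal t := by
  refine ⟨t.2, fun x₁ hx₁ x₂ hx₂ hseg => ?_⟩
  obtain ⟨a, b, ha, hb, hab, habt⟩ := hseg
  have hdom : ∀ z, a * (x₁ (z * star z)).re ≤ (t.1 (z * star z)).re := by
    intro z
    obtain ⟨r, hr, hr0⟩ := (isNonnegTrace ⟨x₂, hx₂⟩).nonneg z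
    rw [← habt]
    simp only [LinearMap.add_apply, LinearMap.smul_apply, Complex.real_smul, Complex.add_re,
      Complex.re_ofReal_mul]
    change x₂ _ = _ at hr
    rw [hr, Complex.ofReal_re]
    nlinarith [mul_nonneg hb.le hr0]
  refine IsProductTrace.eq hδ.ne' ⟨hx₁.2.1, ?_⟩ ht (hx₁.1.trans t.2.1.symm)
  intro x
  obtain ⟨n, hn⟩ := exists_mem_initial x
  obtain ⟨k, hxk⟩ := exists_mem_initial (star x)
  set l := max n k with hl
  have hxl : x ∈ initial δ l := initial_mono (le_max_left _ _) hn
  have hsx : star x * x ∈ initial δ l := mul_mem (initial_mono (le_max_right _ _) hxk) hxl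
  have hτ : conj τ = τ := by
    have h := trace_star t (e 0)
    rwa [star_e, ht.apply_e, t.2.1, mul_one, eq_comm] at h
  filter_upwards [eventually_ge_atTop (l + 1)] with m hm
  -- Centered copies of the generator, two sites apart so that different ones commute and the
  -- product property applies across them.
  let u : ℕ → TL δ := fun j => e (m + 2 * j) - algebraMap ℂ _ τ
  have hu : ∀ j, star (u j) = u j := fun j => by
    simp only [u, star_sub, star_e, star_algebraMap, hτ]
  have htu : ∀ j i, t.1 (x * u j * star (x * u i)) = t.1 (star x * x * u j * u i) := by
    intro j i
    rw [star_mul, hu, ← mul_assoc, t.2.2.1]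
    simp only [mul_assoc]
  have hmul : ∀ (y : TL δ) (j : ℕ), y * u j = y * e (m + 2 * j) - τ • y := by
    intro y j
    rw [mul_sub, ← Algebra.commutes, ← Algebra.smul_def]
  have hlt : ∀ j i, j < i → t.1 (x * u j * star (x * u i)) = 0 := by
    intro j i hji
    have hmem : star x * x * u j ∈ initial δ (m + 2 * j + 1) :=
      mul_mem (initial_mono (by omega) hsx)
        (sub_mem (e_mem_initial (Nat.lt_succ_self _)) (Subalgebra.algebraMap_mem _ _))
    rw [htu, hmul, map_sub, ht.mul_e (by omega) hmem, map_smul, smul_eq_mul, sub_self]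
  set B : ℂ := (τ * δ - τ ^ 2) * t.1 (star x * x) with hB
  have hdiag : ∀ j, t.1 (x * u j * star (x * u j)) = B := by
    intro j
    have he : t.1 (star x * x * e (m + 2 * j)) = τ * t.1 (star x * x) :=
      ht.mul_e (by omega) hsx
    rw [htu, hmul, hmul, sub_mul, smul_mul_assoc, mul_assoc _ (e _), e_sq]
    simp only [map_sub, map_smul, smul_sub, mul_smul_comm, smul_eq_mul, he]
    ring
  have hoff : ∀ j i, t.1 (x * u j * star (x * u i)) = if j = i then B else 0 := by
    intro j i
    rcases lt_trichotomy j i with h | rfl | h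
    · rw [hlt j i h, if_neg h.ne]
    · rw [hdiag, if_pos rfl]
    · rw [if_neg h.ne', ← map_zero conj, ← hlt i j h, ← trace_star,
        star_mul (x * u i), star_star]
  -- The defect of the component `x₁`. It is the same at every site, because `x₁` is a trace.
  set d := x₁ (x * e m) - τ * x₁ x with hd
  have hx₁u : ∀ j, x₁ (x * u j) = d := by
    intro j
    rw [hmul, map_sub, trace_mul_e_eq hx₁.2.1 (Or.inl hm) hxl (Nat.le_add_right m _), map_smul,
      smul_eq_mul]
  -- Cauchy–Schwarz on a sum of `N` orthogonal terms: the squared mean grows like `N²`, the variance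
  -- only like `N`, which forces `d = 0`.
  have hineq : ∀ N : ℕ, a * (N * ‖d‖) ^ 2 ≤ N * B.re := by
    intro N
    let Z := ∑ j ∈ Finset.range N, x * u j
    have h1 : x₁ Z = N * d := by
      simp only [Z, map_sum, hx₁u, Finset.sum_const, Finset.card_range, nsmul_eq_mul]
    have h2 : t.1 (Z * star Z) = N * B := by
      simp only [Z, star_sum, Finset.sum_mul_sum, map_sum, hoff, Finset.sum_ite_eq,
        Finset.mem_range]
      rw [Finset.sum_congr rfl fun i hi => if_pos (Finset.mem_range.1 hi)]
      simp
    have h3 := (isNonnegTrace ⟨x₁, hx₁⟩).cauchySchwarz Z 1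
    change ‖x₁ _‖ ^ 2 ≤ (x₁ _).re * (x₁ _).re at h3
    rw [star_one, mul_one, mul_one, hx₁.1, Complex.one_re, mul_one, h1, norm_mul,
      Complex.norm_natCast] at h3
    have h4 := hdom Z
    rw [h2] at h4
    have h5 : ((N : ℂ) * B).re = N * B.re := by simp
    rw [← h5]
    exact (mul_le_mul_of_nonneg_left h3 ha.le).trans h4
  have hd0 : d = 0 := by
    by_contra hne
    have hpos : 0 < a * ‖d‖ ^ 2 := by positivity
    obtain ⟨N, hN⟩ := exists_nat_gt (B.re / (a * ‖d‖ ^ 2))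
    rw [div_lt_iff₀ hpos] at hN
    have h1 := hineq (N + 1)
    push_cast at h1
    have h2 : (0 : ℝ) < N + 1 := by positivity
    nlinarith [mul_pos h2 hpos]
  exact sub_eq_zero.1 hd0

/-! ### Jones–Wenzl idempotents and strict positivity. -/

theorem middle_le_succ (n : ℕ) : middle δ n ≤ middle δ (n + 1) := by
  rw [middle, Submodule.span_le]
  rintro x ⟨a, ha, b, hb, rfl⟩
  have h : a * e n * b = a * e n * e (n + 1) * (e n * b) := by
    calc a * e n * b = a * (e n * e (n + 1) * e n) * b := by rw [e_up]
      _ = _ := by simp only [mul_assoc]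
  rw [h]
  exact mem_middle (mul_mem (initial_mono n.le_succ ha) (e_mem_initial n.lt_succ_self))
    (mul_mem (e_mem_initial n.lt_succ_self) (initial_mono n.le_succ hb))

/-- The Jones-Wenzl idempotents. -/
theorem exists_jonesWenzl (hδ : 2 < δ) (n : ℕ) :
    ∃ g ∈ initial δ (n + 1), ∃ h ∈ initial δ n, ∃ r : ℝ, 1 < r ∧
      (∀ i ≤ n, e i * g = 0 ∧ g * e i = 0) ∧ g * g = g ∧ h * g = g ∧ g * h = g ∧
      e (n + 1) * g * e (n + 1) = (r : ℂ) • (h * e (n + 1)) ∧ 1 - g ∈ middle δ n := by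
  -- The coefficients obey `r ↦ δ - r⁻¹`. For `δ > 2` the bound `r > 1` is preserved, so the
  -- recursion never divides by zero.
  have hr : ∀ s : ℝ, 1 < s → 1 < δ - s⁻¹ := by
    intro s hs
    have := inv_lt_one_of_one_lt₀ hs
    linarith
  have hr' : ∀ s : ℝ, 1 < s → (s : ℂ)⁻¹ * s = 1 := by
    intro s hs
    exact inv_mul_cancel₀ (by exact_mod_cast (zero_lt_one.trans hs).ne')
  induction n with
  | zero =>
    have h1 : (e 0 * (1 - (δ : ℂ)⁻¹ • e 0) : TL δ) = 0 := by
      rw [mul_sub, mul_one, mul_smul_comm, e_sq, smul_smul, hr' δ (by linarith), one_smul, sub_self]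
    have h2 : ((1 - (δ : ℂ)⁻¹ • e 0) * e 0 : TL δ) = 0 := by
      rw [sub_mul, one_mul, smul_mul_assoc, e_sq, smul_smul, hr' δ (by linarith), one_smul,
        sub_self]
    refine ⟨1 - (δ : ℂ)⁻¹ • e 0, sub_mem (one_mem _) (Subalgebra.smul_mem _
      (e_mem_initial zero_lt_one) _), 1, one_mem _, δ - δ⁻¹, hr δ (by linarith), ?_, ?_,
      one_mul _, mul_one _, ?_, ?_⟩
    · intro i hi
      obtain rfl := Nat.le_zero.1 hi
      exact ⟨h1, h2⟩
    · rw [sub_mul, one_mul, smul_mul_assoc, h1, smul_zero, sub_zero]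
    · rw [mul_sub, sub_mul, mul_one, e_sq, mul_smul_comm, smul_mul_assoc, e_down, one_mul]
      push_cast
      rw [sub_smul]
    · rw [sub_sub_cancel]
      refine Submodule.smul_mem _ _ ?_
      rw [← one_mul (e 0), ← mul_one (1 * e 0)]
      exact mem_middle (one_mem _) (one_mem _)
  | succ n ih =>
    obtain ⟨g, hg, h, hh, r, hr1, hk, hgg, hhg, hgh, he, hmid⟩ := ih
    have hce := (commute_of_mem_initial (Or.inl n.lt_succ_self) hh).eq
    have hcg := (commute_of_mem_initial (Or.inl (n + 1).lt_succ_self) hg).eq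
    -- Wenzl's recursion, with `h` the idempotent one level below `g`. The coefficient is chosen so
    -- that `e (n + 1)` kills `g'`.
    set g' := g - (r : ℂ)⁻¹ • (g * e (n + 1) * g) with hg'
    have hgg' : g * g' = g' := by
      rw [hg', mul_sub, mul_smul_comm, hgg, ← mul_assoc, ← mul_assoc, hgg]
    have hg'g : g' * g = g' := by
      rw [hg', sub_mul, smul_mul_assoc, hgg, mul_assoc _ g g, hgg]
    have hlast : e (n + 1) * g' = 0 ∧ g' * e (n + 1) = 0 := by
      constructor
      · rw [hg', mul_sub, mul_smul_comm, ← mul_assoc, ← mul_assoc, he, smul_mul_assoc, smul_smul,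
          hr' r hr1, one_smul, hce, mul_assoc, hhg, sub_self]
      · rw [hg', sub_mul, smul_mul_assoc, mul_assoc, mul_assoc, ← mul_assoc (e (n + 1)), he,
          mul_smul_comm, smul_smul, hr' r hr1, one_smul, ← mul_assoc, hgh, sub_self]
    refine ⟨g', sub_mem (initial_mono (Nat.le_succ _) hg) (Subalgebra.smul_mem _ (mul_mem (mul_mem
      (initial_mono (Nat.le_succ _) hg) (e_mem_initial (Nat.lt_succ_self _)))
      (initial_mono (Nat.le_succ _) hg)) _), g, hg, δ - r⁻¹, hr r hr1, ?_, ?_, hgg', hg'g, ?_, ?_⟩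
    · intro i hi
      rcases Nat.le_succ_iff.1 hi with hi | rfl
      · constructor
        · rw [← hgg', ← mul_assoc, (hk i hi).1, zero_mul]
        · rw [← hg'g, mul_assoc, (hk i hi).2, mul_zero]
      · exact hlast
    · nth_rewrite 2 [hg']
      rw [mul_sub, mul_smul_comm, ← mul_assoc, ← mul_assoc, hg'g, hlast.2, zero_mul, smul_zero,
        sub_zero]
    · calc e (n + 1 + 1) * g' * e (n + 1 + 1)
          = e (n + 1 + 1) * g * e (n + 1 + 1)
            - (r : ℂ)⁻¹ • ((e (n + 1 + 1) * g) * e (n + 1) * (g * e (n + 1 + 1))) := by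
            rw [hg', mul_sub, sub_mul, mul_smul_comm, smul_mul_assoc]
            simp only [mul_assoc]
        _ = g * (e (n + 1 + 1) * e (n + 1 + 1))
            - (r : ℂ)⁻¹ • (g * (e (n + 1 + 1) * e (n + 1) * e (n + 1 + 1)) * g) := by
            have h1 : e (n + 1 + 1) * g * e (n + 1) * (g * e (n + 1 + 1))
                = g * e (n + 1 + 1) * e (n + 1) * (e (n + 1 + 1) * g) := by rw [hcg]
            have h2 : e (n + 1 + 1) * g * e (n + 1 + 1) = g * (e (n + 1 + 1) * e (n + 1 + 1)) := by
              rw [← hcg, mul_assoc]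
            rw [h1, h2]
            simp only [mul_assoc]
        _ = _ := by
            rw [e_sq, e_down, mul_smul_comm, mul_assoc, ← hcg, ← mul_assoc, hgg]
            push_cast
            rw [sub_smul]
    · have h1 : 1 - g' = (1 - g) + (r : ℂ)⁻¹ • (g * e (n + 1) * g) := by rw [hg']; abel
      rw [h1]
      exact add_mem (middle_le_succ n hmid) (Submodule.smul_mem _ _ (mem_middle hg hg))

/-- The character of `TL_∞` that vanishes on the generators. -/
noncomputable def augmentation (δ : ℝ) : TL δ →ₐ[ℂ] ℂ :=
  RingQuot.liftAlgHom ℂ (s := TLRel δ)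
    ⟨FreeAlgebra.lift ℂ (fun _ => (0 : ℂ)), by
      intro x y h
      cases h with
      | sq i => rw [map_mul, map_smul]; simp
      | _ => simp⟩

theorem augmentation_e (i : ℕ) : augmentation δ (e i) = 0 :=
  (RingQuot.liftAlgHom_mkAlgHom_apply ℂ _ _ _).trans (FreeAlgebra.lift_ι_apply _ _)

/-- Only the constant term of `x` survives against a vector killed by the generators. -/
theorem mul_eq_augmentation_smul {n : ℕ} {g : TL δ} (hg : ∀ i < n, e i * g = 0) {x : TL δ}
    (hx : x ∈ initial δ n) : x * g = augmentation δ x • g := by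
  induction hx using Algebra.adjoin_induction with
  | mem x hx =>
    obtain ⟨i, hi, rfl⟩ := hx
    rw [hg i hi, augmentation_e, zero_smul]
  | algebraMap r => rw [AlgHom.commutes, ← Algebra.smul_def]; rfl
  | add x y _ _ hx hy => rw [add_mul, hx, hy, map_add, add_smul]
  | mul x y _ _ hx hy => rw [mul_assoc, hy, mul_smul_comm, hx, map_mul, smul_smul, mul_comm]

theorem mul_eq_augmentation_smul' {n : ℕ} {g : TL δ} (hg : ∀ i < n, g * e i = 0) {x : TL δ}
    (hx : x ∈ initial δ n) : g * x = augmentation δ x • g := by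
  induction hx using Algebra.adjoin_induction with
  | mem x hx =>
    obtain ⟨i, hi, rfl⟩ := hx
    rw [hg i hi, augmentation_e, zero_smul]
  | algebraMap r => rw [AlgHom.commutes, ← Algebra.commutes, ← Algebra.smul_def]; rfl
  | add x y _ _ hx hy => rw [mul_add, hx, hy, map_add, add_smul]
  | mul x y _ _ hx hy => rw [← mul_assoc, hx, smul_mul_assoc, hy, map_mul, smul_smul]

theorem star_mem_initial {n : ℕ} {x : TL δ} (hx : x ∈ initial δ n) : star x ∈ initial δ n := by
  induction hx using Algebra.adjoin_induction with
  | mem x hx =>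
    obtain ⟨i, hi, rfl⟩ := hx
    rw [star_e]
    exact e_mem_initial hi
  | algebraMap r => rw [star_algebraMap]; exact Subalgebra.algebraMap_mem _ _
  | add x y _ _ hx hy => rw [star_add]; exact add_mem hx hy
  | mul x y _ _ hx hy => rw [star_mul]; exact mul_mem hy hx

/-- A nonnegative product trace whose null space lies in the kernel of the augmentation is
strictly positive. -/
theorem IsNonnegTrace.eq_zero_of_null (hδ : 2 < δ) {t : TL δ →ₗ[ℂ] ℂ} {τ : ℂ}
    (ht : IsNonnegTrace t) (hp : IsProductTrace t τ) (hτ : τ ≠ 0)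
    (haug : ∀ x, t (x * star x) = 0 → augmentation δ x = 0) {x : TL δ}
    (hx : t (x * star x) = 0) : x = 0 := by
  have hnull : ∀ x : TL δ, t (x * star x) = 0 → ∀ y, t (x * y) = 0 := by
    intro x hx y
    have h := ht.cauchySchwarz x (star y)
    rw [hx, star_star, Complex.zero_re, zero_mul] at h
    simpa using le_antisymm h (by positivity)
  suffices h : ∀ n, ∀ x ∈ initial δ n, (∀ y, t (x * y) = 0) → x = 0 by
    obtain ⟨n, hn⟩ := exists_mem_initial x
    exact h n x hn (hnull x hx)
  intro n
  induction n with
  | zero =>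
    intro x hx h
    rw [initial_zero, Algebra.mem_bot] at hx
    obtain ⟨c, rfl⟩ := hx
    have := haug _ (h _)
    rw [AlgHom.commutes] at this
    rw [show c = 0 from this, map_zero]
  | succ n ih =>
    intro x hx h
    obtain ⟨g, -, -, -, -, -, hk, hgg, -, -, -, hmid⟩ := exists_jonesWenzl hδ (n + 1)
    have haugx : augmentation δ x = 0 := haug x (h _)
    have hxg : x * g = 0 := by
      rw [mul_eq_augmentation_smul (fun i hi => (hk i hi.le).1) hx, haugx, zero_smul]
    have hgx : g * x = 0 := by
      rw [mul_eq_augmentation_smul' (fun i hi => (hk i hi.le).2) hx, haugx, zero_smul]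
    -- Compression by `e (n + 1)` gives `y * e (n + 1)` with `y` one level down. The product
    -- property and `τ ≠ 0` make `y` null, so the induction hypothesis applies.
    have hmm : ∀ a ∈ initial δ (n + 1), ∀ b ∈ initial δ (n + 1),
        e (n + 1) * (a * x * b) * e (n + 1) = 0 := by
      intro a ha b hb
      obtain ⟨y, hy, hye⟩ := exists_e_mul_mul_e (n + 1) (a * x * b)
        (mul_mem (mul_mem ha hx) hb)
      have h1 : t (y * star y) = 0 := by
        have h2 : t (y * e (n + 1) * star y) = 0 := by
          rw [← hye]
          have h3 : e (n + 1) * (a * x * b) * e (n + 1) * star y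
              = (e (n + 1) * a) * (x * (b * (e (n + 1) * star y))) := by simp only [mul_assoc]
          rw [h3, ht.comm, mul_assoc]
          exact h _
        rw [ht.comm, ← mul_assoc, hp.mul_e (Or.inl n.lt_succ_self)
          (mul_mem (star_mem_initial hy) hy), mul_eq_zero, or_iff_right hτ] at h2
        rw [ht.comm, h2]
      rw [hye, ih y hy (hnull y h1), zero_mul]
    have hxu : ∀ u ∈ middle δ (n + 1), ∀ v ∈ middle δ (n + 1), u * x * v = 0 := by
      intro u hu v hv
      induction hu using Submodule.span_induction with
      | mem u hu =>
        obtain ⟨a, -, b, hb, rfl⟩ := hu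
        induction hv using Submodule.span_induction with
        | mem v hv =>
          obtain ⟨c, hc, d, -, rfl⟩ := hv
          have h3 : a * e (n + 1) * b * x * (c * e (n + 1) * d)
              = a * (e (n + 1) * (b * x * c) * e (n + 1)) * d := by simp only [mul_assoc]
          rw [h3, hmm b hb c hc, mul_zero, zero_mul]
        | zero => rw [mul_zero]
        | add v w _ _ hv hw => rw [mul_add, hv, hw, add_zero]
        | smul c v _ hv => rw [mul_smul_comm, hv, smul_zero]
      | zero => rw [zero_mul, zero_mul]
      | add v w _ _ hv hw => rw [add_mul, add_mul, hv, hw, add_zero]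
      | smul c v _ hv => rw [smul_mul_assoc, smul_mul_assoc, hv, smul_zero]
    -- With `g` the Jones–Wenzl idempotent, `gx = xg = 0`, so `x = (1 - g) x (1 - g)`, and `1 - g`
    -- lies in `middle δ (n + 1)`.
    have h1 := hxu _ hmid _ hmid
    rwa [sub_mul, hgx, one_mul, sub_zero, mul_sub, hxg, mul_one, sub_zero] at h1

/-! ### The spin chain representation. -/

/-- The spin configuration `s` with the sites `i` and `i + 1` exchanged. Configurations are given by
the finite set of occupied sites. -/
def swapSites (i : ℕ) (s : Finset ℕ) : Finset ℕ := s.map (Equiv.swap i (i + 1)).toEmbedding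

@[simp]
theorem mem_swapSites {i j : ℕ} {s : Finset ℕ} :
    j ∈ swapSites i s ↔ Equiv.swap i (i + 1) j ∈ s := by
  rw [swapSites, Finset.mem_map_equiv, Equiv.symm_swap]

@[simp]
theorem swapSites_swapSites (i : ℕ) (s : Finset ℕ) : swapSites i (swapSites i s) = s := by
  ext j
  simp

theorem card_swapSites (i : ℕ) (s : Finset ℕ) : (swapSites i s).card = s.card :=
  Finset.card_map _

theorem swapSites_comm {i j : ℕ} (h : i + 1 < j) (s : Finset ℕ) :
    swapSites i (swapSites j s) = swapSites j (swapSites i s) := by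
  ext k
  simp only [mem_swapSites, Equiv.swap_apply_def]
  congr! 1
  split_ifs <;> omega

/-- The action of a generator on functions of the spin configuration. -/
noncomputable def spinOp (r : ℝ) (i : ℕ) : Module.End ℂ (Finset ℕ → ℂ) where
  -- On the singly occupied states of sites `i`, `i + 1` this is the rank one matrix with rows `(r,
  -- 1)` and `(1, r⁻¹)`, of trace `r + r⁻¹`. It is zero on the empty and full states.
  toFun f s :=
    if i ∈ s ∧ i + 1 ∉ s then r * f s + f (swapSites i s)
    else if i ∉ s ∧ i + 1 ∈ s then (r : ℂ)⁻¹ * f s + f (swapSites i s) else 0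
  map_add' f g := by
    ext s
    simp only [Pi.add_apply]
    split_ifs <;> ring
  map_smul' c f := by
    ext s
    simp only [Pi.smul_apply, smul_eq_mul, RingHom.id_apply]
    split_ifs <;> ring

theorem spinOp_apply (r : ℝ) (i : ℕ) (f : Finset ℕ → ℂ) (s : Finset ℕ) :
    spinOp r i f s =
      if i ∈ s ∧ i + 1 ∉ s then r * f s + f (swapSites i s)
      else if i ∉ s ∧ i + 1 ∈ s then (r : ℂ)⁻¹ * f s + f (swapSites i s) else 0 := rfl

theorem swap_succ_left (i : ℕ) : Equiv.swap (i + 1) (i + 1 + 1) i = i :=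
  Equiv.swap_apply_of_ne_of_ne (by omega) (by omega)

theorem swap_succ_right (i : ℕ) : Equiv.swap i (i + 1) (i + 1 + 1) = i + 1 + 1 :=
  Equiv.swap_apply_of_ne_of_ne (by omega) (by omega)

theorem spinOp_sq {r : ℝ} (hr : r ≠ 0) (hδ : δ = r + r⁻¹) (i : ℕ) :
    spinOp r i * spinOp r i = (δ : ℂ) • spinOp r i := by
  have hr' : (r : ℂ) ≠ 0 := by exact_mod_cast hr
  ext f s
  by_cases h1 : i ∈ s <;> by_cases h2 : i + 1 ∈ s <;>
    simp [spinOp_apply, h1, h2, hδ] <;> field_simp <;> ring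

theorem spinOp_up {r : ℝ} (hr : r ≠ 0) (i : ℕ) :
    spinOp r i * spinOp r (i + 1) * spinOp r i = spinOp r i := by
  have hr' : (r : ℂ) ≠ 0 := by exact_mod_cast hr
  ext f s
  by_cases h1 : i ∈ s <;> by_cases h2 : i + 1 ∈ s <;> by_cases h3 : i + 1 + 1 ∈ s <;>
    simp [spinOp_apply, h1, h2, h3, swap_succ_left, swap_succ_right] <;> field_simp <;> ring

theorem spinOp_down {r : ℝ} (hr : r ≠ 0) (i : ℕ) :
    spinOp r (i + 1) * spinOp r i * spinOp r (i + 1) = spinOp r (i + 1) := by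
  have hr' : (r : ℂ) ≠ 0 := by exact_mod_cast hr
  ext f s
  by_cases h1 : i ∈ s <;> by_cases h2 : i + 1 ∈ s <;> by_cases h3 : i + 1 + 1 ∈ s <;>
    simp [spinOp_apply, h1, h2, h3, swap_succ_left, swap_succ_right] <;> field_simp <;> ring

theorem spinOp_comm (r : ℝ) {i j : ℕ} (h : i + 1 < j) :
    spinOp r i * spinOp r j = spinOp r j * spinOp r i := by
  ext f s
  have e1 : Equiv.swap i (i + 1) j = j := Equiv.swap_apply_of_ne_of_ne (by omega) (by omega)
  have e2 : Equiv.swap i (i + 1) (j + 1) = j + 1 :=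
    Equiv.swap_apply_of_ne_of_ne (by omega) (by omega)
  have e3 : Equiv.swap j (j + 1) i = i := Equiv.swap_apply_of_ne_of_ne (by omega) (by omega)
  have e4 : Equiv.swap j (j + 1) (i + 1) = i + 1 :=
    Equiv.swap_apply_of_ne_of_ne (by omega) (by omega)
  by_cases h1 : i ∈ s <;> by_cases h2 : i + 1 ∈ s <;> by_cases h3 : j ∈ s <;>
    by_cases h4 : j + 1 ∈ s <;>
    simp [spinOp_apply, h1, h2, h3, h4, e1, e2, e3, e4, swapSites_comm h] <;> ring

/-- The spin chain representation of `TL_∞`. -/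
noncomputable def spinRep {r : ℝ} (hr : r ≠ 0) (hδ : δ = r + r⁻¹) :
    TL δ →ₐ[ℂ] Module.End ℂ (Finset ℕ → ℂ) :=
  RingQuot.liftAlgHom ℂ (s := TLRel δ)
    ⟨FreeAlgebra.lift ℂ (spinOp r), by
      intro x y h
      cases h with
      | sq i => rw [map_mul, map_smul, FreeAlgebra.lift_ι_apply, spinOp_sq hr hδ]
      | up i => simp only [map_mul, FreeAlgebra.lift_ι_apply, spinOp_up hr]
      | down i => simp only [map_mul, FreeAlgebra.lift_ι_apply, spinOp_down hr]
      | comm i j h => simp only [map_mul, FreeAlgebra.lift_ι_apply, spinOp_comm r h]⟩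

theorem spinRep_e {r : ℝ} (hr : r ≠ 0) (hδ : δ = r + r⁻¹) (i : ℕ) :
    spinRep hr hδ (e i) = spinOp r i :=
  (RingQuot.liftAlgHom_mkAlgHom_apply ℂ _ _ _).trans (FreeAlgebra.lift_ι_apply _ _)

/-- The projection onto the configurations with an occupied site `m`. -/
def occupied (m : ℕ) : Module.End ℂ (Finset ℕ → ℂ) where
  toFun f s := if m ∈ s then f s else 0
  map_add' f g := by
    ext s
    by_cases h : m ∈ s <;> simp [h]
  map_smul' c f := by
    ext s
    by_cases h : m ∈ s <;> simp [h]

/-- The operator that occupies the site `m`. -/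
def occupy (m : ℕ) : Module.End ℂ (Finset ℕ → ℂ) where
  toFun f s := if m ∈ s then f (s.erase m) else 0
  map_add' f g := by
    ext s
    by_cases h : m ∈ s <;> simp [h]
  map_smul' c f := by
    ext s
    by_cases h : m ∈ s <;> simp [h]

/-- The operator that weighs configurations by the number of occupied sites. -/
noncomputable def charge (κ : ℝ) : Module.End ℂ (Finset ℕ → ℂ) where
  toFun f s := (κ : ℂ) ^ s.card * f s
  map_add' f g := by
    ext s
    simp [mul_add]
  map_smul' c f := by
    ext s
    simp [mul_left_comm]

theorem occupied_apply (m : ℕ) (f : Finset ℕ → ℂ) (s : Finset ℕ) :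
    occupied m f s = if m ∈ s then f s else 0 := rfl

theorem occupy_apply (m : ℕ) (f : Finset ℕ → ℂ) (s : Finset ℕ) :
    occupy m f s = if m ∈ s then f (s.erase m) else 0 := rfl

theorem charge_apply (κ : ℝ) (f : Finset ℕ → ℂ) (s : Finset ℕ) :
    charge κ f s = (κ : ℂ) ^ s.card * f s := rfl

theorem swapSites_erase {i m : ℕ} (h : i + 1 < m) (s : Finset ℕ) :
    swapSites i (s.erase m) = (swapSites i s).erase m := by
  ext j
  have h1 : Equiv.swap i (i + 1) m = m := Equiv.swap_apply_of_ne_of_ne (by omega) (by omega)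
  have h2 : Equiv.swap i (i + 1) j = m ↔ j = m := by
    rw [Equiv.swap_apply_eq_iff, h1]
  simp [h2]

theorem commute_spinOp_occupied (r : ℝ) {i m : ℕ} (h : i + 1 < m) :
    Commute (spinOp r i) (occupied m) := by
  ext f s
  have h1 : Equiv.swap i (i + 1) m = m := Equiv.swap_apply_of_ne_of_ne (by omega) (by omega)
  by_cases hm : m ∈ s <;> simp [spinOp_apply, occupied_apply, h1, hm]

theorem commute_spinOp_occupy (r : ℝ) {i m : ℕ} (h : i + 1 < m) :
    Commute (spinOp r i) (occupy m) := by
  ext f s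
  have h1 : Equiv.swap i (i + 1) m = m := Equiv.swap_apply_of_ne_of_ne (by omega) (by omega)
  have h2 : i ≠ m := by omega
  have h3 : i + 1 ≠ m := by omega
  by_cases hm : m ∈ s <;> simp [spinOp_apply, occupy_apply, h1, h2, h3, hm, swapSites_erase h]

theorem commute_spinOp_charge (r κ : ℝ) (i : ℕ) : Commute (spinOp r i) (charge κ) := by
  ext f s
  simp only [Module.End.mul_apply, spinOp_apply, charge_apply, card_swapSites]
  split_ifs <;> ring

/-! ### Matrix coefficients and the weighted traces on finite chains. -/

section SpinChain

variable {r : ℝ} (hr : r ≠ 0) (hδ : δ = r + r⁻¹)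

theorem commute_spinRep {n : ℕ} {Z : Module.End ℂ (Finset ℕ → ℂ)}
    (hZ : ∀ i < n, Commute (spinOp r i) Z) {x : TL δ} (hx : x ∈ initial δ n) :
    Commute (spinRep hr hδ x) Z := by
  induction hx using Algebra.adjoin_induction with
  | mem x hx =>
    obtain ⟨i, hi, rfl⟩ := hx
    rw [spinRep_e]
    exact hZ i hi
  | algebraMap c => rw [AlgHom.commutes]; exact Algebra.commute_algebraMap_left c _
  | add x y _ _ hx hy => rw [map_add]; exact hx.add_left hy
  | mul x y _ _ hx hy => rw [map_mul]; exact hx.mul_left hy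

/-- The matrix coefficients of the spin chain representation. -/
noncomputable def spinCoeff (x : TL δ) (s u : Finset ℕ) : ℂ :=
  spinRep hr hδ x (Pi.single u 1) s

/-- The first `n` generators touch only the sites `0, …, n`, so site `m` is a spectator. -/
theorem spinCoeff_eq_zero {n m : ℕ} (h : n < m) {x : TL δ} (hx : x ∈ initial δ n)
    {s u : Finset ℕ} (hs : m ∈ s) (hu : m ∉ u) : spinCoeff hr hδ x s u = 0 := by
  have hc := commute_spinRep hr hδ (Z := occupied m)
    (fun i hi => commute_spinOp_occupied r (by omega)) hx
  have h0 : occupied m (Pi.single u 1) = 0 := by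
    ext v
    rw [occupied_apply, Pi.zero_apply, ite_eq_right_iff]
    rintro hv
    rw [Pi.single_eq_of_ne]
    rintro rfl
    exact hu hv
  have h1 := congrFun (LinearMap.congr_fun hc.eq (Pi.single u 1)) s
  rw [Module.End.mul_apply, h0, map_zero, Module.End.mul_apply, occupied_apply, if_pos hs] at h1
  exact h1.symm

theorem spinCoeff_insert {n m : ℕ} (h : n < m) {x : TL δ} (hx : x ∈ initial δ n)
    {s u : Finset ℕ} (hs : m ∉ s) (hu : m ∉ u) :
    spinCoeff hr hδ x (insert m s) (insert m u) = spinCoeff hr hδ x s u := by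
  have hc := commute_spinRep hr hδ (Z := occupy m)
    (fun i hi => commute_spinOp_occupy r (by omega)) hx
  have h0 : occupy m (Pi.single u 1) = Pi.single (insert m u) 1 := by
    ext v
    rw [occupy_apply, Pi.single_apply, Pi.single_apply]
    by_cases hv : m ∈ v
    · rw [if_pos hv]
      congr 1
      rw [eq_iff_iff]
      constructor
      · rintro rfl
        rw [Finset.insert_erase hv]
      · rintro rfl
        rw [Finset.erase_insert hu]
    · rw [if_neg hv, if_neg]
      rintro rfl
      exact hv (Finset.mem_insert_self _ _)
  have h1 := congrFun (LinearMap.congr_fun hc.eq (Pi.single u 1)) (insert m s)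
  rw [Module.End.mul_apply, h0, Module.End.mul_apply, occupy_apply,
    if_pos (Finset.mem_insert_self _ _), Finset.erase_insert hs] at h1
  exact h1

/-- Conservation of particle number, in the form needed to move weights in the trace. -/
theorem spinCoeff_charge (κ : ℝ) (x : TL δ) (s u : Finset ℕ) :
    (κ : ℂ) ^ s.card * spinCoeff hr hδ x s u = (κ : ℂ) ^ u.card * spinCoeff hr hδ x s u := by
  obtain ⟨n, hn⟩ := exists_mem_initial x
  have hc := commute_spinRep hr hδ (Z := charge κ) (fun i _ => commute_spinOp_charge r κ i) hn
  have h0 : charge κ (Pi.single u 1) = (κ : ℂ) ^ u.card • Pi.single u 1 := by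
    ext v
    rw [charge_apply, Pi.smul_apply, smul_eq_mul]
    by_cases h : v = u
    · rw [h]
    · rw [Pi.single_eq_of_ne h, mul_zero, mul_zero]
  have h1 := congrFun (LinearMap.congr_fun hc.eq (Pi.single u 1)) s
  rw [Module.End.mul_apply, h0, map_smul, Module.End.mul_apply, charge_apply] at h1
  exact h1.symm

theorem spinCoeff_mul {n N : ℕ} (h : n < N) (x : TL δ) {y : TL δ} (hy : y ∈ initial δ n)
    (s : Finset ℕ) {u : Finset ℕ} (hu : u ⊆ Finset.range N) :
    spinCoeff hr hδ (x * y) s u =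
      ∑ v ∈ (Finset.range N).powerset, spinCoeff hr hδ x s v * spinCoeff hr hδ y v u := by
  have h0 : spinRep hr hδ y (Pi.single u 1) =
      ∑ v ∈ (Finset.range N).powerset, spinCoeff hr hδ y v u • Pi.single v (1 : ℂ) := by
    ext w
    simp only [Finset.sum_apply, Pi.smul_apply, smul_eq_mul, Pi.single_apply, mul_ite, mul_one,
      mul_zero, Finset.sum_ite_eq, Finset.mem_powerset]
    split_ifs with hw
    · rfl
    · obtain ⟨m, hm, hmN⟩ := Finset.not_subset.1 hw
      rw [Finset.mem_range, not_lt] at hmN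
      exact spinCoeff_eq_zero hr hδ (h.trans_le hmN) hy hm
        fun hmu => absurd (Finset.mem_range.1 (hu hmu)) (by omega)
  rw [spinCoeff, map_mul, Module.End.mul_apply, h0, map_sum, Finset.sum_apply]
  refine Finset.sum_congr rfl fun v _ => ?_
  rw [map_smul, Pi.smul_apply, smul_eq_mul, mul_comm]
  rfl

/-- The generators act by real symmetric matrices, as `r` is real. -/
theorem spinCoeff_star (x : TL δ) (s u : Finset ℕ) :
    spinCoeff hr hδ (star x) s u = conj (spinCoeff hr hδ x u s) := by
  induction x using TL.induction generalizing s u with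
  | hs c =>
    rw [star_algebraMap, spinCoeff, spinCoeff, AlgHom.commutes, AlgHom.commutes,
      Module.algebraMap_end_apply, Module.algebraMap_end_apply]
    simp [Pi.single_apply, eq_comm, apply_ite conj]
  | he i =>
    rw [star_e, spinCoeff, spinCoeff, spinRep_e, spinOp_apply, spinOp_apply]
    by_cases h : s = u
    · subst h
      simp only [Pi.single_apply]
      split_ifs <;> simp
    · rw [Pi.single_eq_of_ne h, Pi.single_eq_of_ne (Ne.symm h)]
      by_cases h2 : swapSites i s = u
      · subst h2
        by_cases h3 : i ∈ s <;> by_cases h4 : i + 1 ∈ s <;> simp [h3, h4]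
      · have h3 : swapSites i u ≠ s := by
          rintro rfl
          exact h2 (swapSites_swapSites i u)
        simp [Pi.single_eq_of_ne h2, Pi.single_eq_of_ne h3]
  | hm x y hx hy =>
    obtain ⟨n, hn⟩ := exists_mem_initial x
    obtain ⟨k, hk⟩ := exists_mem_initial y
    obtain ⟨a, ha⟩ := s.exists_nat_subset_range
    obtain ⟨b, hb⟩ := u.exists_nat_subset_range
    set N := n + k + a + b + 1
    have hs : s ⊆ Finset.range N := ha.trans (Finset.range_mono (by omega))
    have hu : u ⊆ Finset.range N := hb.trans (Finset.range_mono (by omega))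
    rw [star_mul, spinCoeff_mul hr hδ (N := N) (by omega) _ (star_mem_initial hn) _ hu,
      spinCoeff_mul hr hδ (N := N) (by omega) _ hk _ hs, map_sum]
    refine Finset.sum_congr rfl fun v _ => ?_
    rw [hx, hy, map_mul, mul_comm]
  | ha x y hx hy =>
    have hadd : ∀ (a b : TL δ) (s u : Finset ℕ), spinCoeff hr hδ (a + b) s u =
        spinCoeff hr hδ a s u + spinCoeff hr hδ b s u := fun a b s u => by
      rw [spinCoeff, map_add]
      rfl
    rw [star_add, hadd, hadd, hx, hy, map_add]

/-- All generators kill the vacuum. -/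
theorem spinCoeff_empty (x : TL δ) : spinCoeff hr hδ x ∅ ∅ = augmentation δ x := by
  have h : spinRep hr hδ x (Pi.single ∅ 1) = augmentation δ x • Pi.single ∅ (1 : ℂ) := by
    induction x using TL.induction with
    | hs c => simp [AlgHom.commutes]
    | he i =>
      rw [augmentation_e, zero_smul, spinRep_e]
      ext s
      have h1 : ∀ j ∈ s, (Pi.single ∅ 1 : Finset ℕ → ℂ) s = 0 := fun j hj =>
        Pi.single_eq_of_ne (Finset.ne_empty_of_mem hj) _
      have h2 : ∀ j ∈ s, (Pi.single ∅ 1 : Finset ℕ → ℂ) (swapSites i s) = 0 := fun j hj =>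
        Pi.single_eq_of_ne (Finset.ne_empty_of_mem
          (a := Equiv.swap i (i + 1) j) (by simpa using hj)) _
      rw [spinOp_apply, Pi.zero_apply]
      split_ifs with h3 h4
      · rw [h1 _ h3.1, h2 _ h3.1, mul_zero, add_zero]
      · rw [h1 _ h4.2, h2 _ h4.2, mul_zero, add_zero]
      · rfl
    | hm x y hx hy =>
      rw [map_mul, Module.End.mul_apply, hy, map_smul, hx, map_mul, smul_smul, mul_comm]
    | ha x y hx hy => rw [map_add, LinearMap.add_apply, hx, hy, map_add, add_smul]
  rw [spinCoeff, h]
  simp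

/-- The trace on the first `N` sites of the spin chain, with weight `κ` at each occupied site. -/
noncomputable def spinTraceAux (κ : ℝ) (N : ℕ) : TL δ →ₗ[ℂ] ℂ where
  toFun x := ∑ s ∈ (Finset.range N).powerset,
    ((1 + κ)⁻¹ ^ N * κ ^ s.card : ℝ) * spinCoeff hr hδ x s s
  map_add' x y := by
    rw [← Finset.sum_add_distrib]
    refine Finset.sum_congr rfl fun s _ => ?_
    rw [spinCoeff, map_add, LinearMap.add_apply, Pi.add_apply, mul_add]
    rfl
  map_smul' c x := by
    rw [RingHom.id_apply, Finset.smul_sum]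
    refine Finset.sum_congr rfl fun s _ => ?_
    rw [spinCoeff, map_smul, LinearMap.smul_apply, Pi.smul_apply, mul_smul_comm]
    rfl

theorem spinTraceAux_apply (κ : ℝ) (N : ℕ) (x : TL δ) :
    spinTraceAux hr hδ κ N x = ∑ s ∈ (Finset.range N).powerset,
      ((1 + κ)⁻¹ ^ N * κ ^ s.card : ℝ) * spinCoeff hr hδ x s s := rfl

theorem sum_powerset_range_succ {M : Type*} [AddCommMonoid M] (N : ℕ) (f : Finset ℕ → M) :
    ∑ s ∈ (Finset.range (N + 1)).powerset, f s =
      ∑ s ∈ (Finset.range N).powerset, (f s + f (insert N s)) := by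
  rw [Finset.range_add_one, Finset.sum_powerset_insert (by simp), Finset.sum_add_distrib]

theorem notMem_of_mem_powerset_range {N m : ℕ} (h : N ≤ m) {s : Finset ℕ}
    (hs : s ∈ (Finset.range N).powerset) : m ∉ s := fun hm =>
  absurd (Finset.mem_range.1 (Finset.mem_powerset.1 hs hm)) (by omega)

theorem spinTraceAux_succ {κ : ℝ} (hκ : 0 < κ) {n N : ℕ} (h : n < N) {x : TL δ}
    (hx : x ∈ initial δ n) : spinTraceAux hr hδ κ (N + 1) x = spinTraceAux hr hδ κ N x := by
  rw [spinTraceAux_apply, spinTraceAux_apply, sum_powerset_range_succ]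
  refine Finset.sum_congr rfl fun s hs => ?_
  have hN := notMem_of_mem_powerset_range le_rfl hs
  rw [spinCoeff_insert hr hδ h hx hN hN, Finset.card_insert_of_notMem hN, ← add_mul,
    ← Complex.ofReal_add]
  congr 2
  have : 1 + κ ≠ 0 := by positivity
  rw [pow_succ, pow_succ]
  field_simp

theorem spinTraceAux_eq {κ : ℝ} (hκ : 0 < κ) {n M N : ℕ} (h : n < M) (hMN : M ≤ N) {x : TL δ}
    (hx : x ∈ initial δ n) : spinTraceAux hr hδ κ N x = spinTraceAux hr hδ κ M x := by
  induction N, hMN using Nat.le_induction with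
  | base => rfl
  | succ N hN ih => rw [spinTraceAux_succ hr hδ hκ (by omega) hx, ih]

theorem spinTraceAux_one {κ : ℝ} (hκ : 0 < κ) (N : ℕ) : spinTraceAux hr hδ κ N 1 = 1 := by
  have h1 : ∀ s, spinCoeff hr hδ 1 s s = 1 := fun s => by simp [spinCoeff]
  have h2 := Finset.sum_pow_mul_eq_add_pow κ 1 (Finset.range N)
  simp only [one_pow, mul_one, Finset.card_range] at h2
  simp only [spinTraceAux_apply, h1, mul_one]
  rw [← Complex.ofReal_sum, ← Finset.mul_sum, h2, add_comm κ, ← mul_pow,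
    inv_mul_cancel₀ (by positivity), one_pow, Complex.ofReal_one]

/-- The density `κ ^ s.card` commutes with the representation, so the weighted matrix trace is
cyclic. -/
theorem spinTraceAux_mul_comm {κ : ℝ} {n N : ℕ} (h : n < N) {x y : TL δ}
    (hx : x ∈ initial δ n) (hy : y ∈ initial δ n) :
    spinTraceAux hr hδ κ N (x * y) = spinTraceAux hr hδ κ N (y * x) := by
  have hexp : ∀ {x y : TL δ}, y ∈ initial δ n → spinTraceAux hr hδ κ N (x * y) =
      ∑ s ∈ (Finset.range N).powerset, ∑ v ∈ (Finset.range N).powerset,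
        ((1 + κ)⁻¹ ^ N * κ ^ s.card : ℝ) * (spinCoeff hr hδ x s v * spinCoeff hr hδ y v s) := by
    intro x y hy
    rw [spinTraceAux_apply]
    refine Finset.sum_congr rfl fun s hs => ?_
    rw [spinCoeff_mul hr hδ h x hy s (Finset.mem_powerset.1 hs), Finset.mul_sum]
  rw [hexp hy, hexp hx, Finset.sum_comm]
  refine Finset.sum_congr rfl fun v _ => Finset.sum_congr rfl fun s _ => ?_
  have h1 := spinCoeff_charge hr hδ κ x s v
  push_cast
  linear_combination ((1 + κ : ℂ)⁻¹ ^ N * spinCoeff hr hδ y v s) * h1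

theorem spinTraceAux_mul_star (κ : ℝ) {n N : ℕ} (h : n < N) {x : TL δ}
    (hx : x ∈ initial δ n) :
    spinTraceAux hr hδ κ N (x * star x) =
      ((∑ s ∈ (Finset.range N).powerset, ∑ v ∈ (Finset.range N).powerset,
        (1 + κ)⁻¹ ^ N * κ ^ s.card * ‖spinCoeff hr hδ x s v‖ ^ 2 : ℝ) : ℂ) := by
  rw [spinTraceAux_apply, Complex.ofReal_sum]
  refine Finset.sum_congr rfl fun s hs => ?_
  rw [spinCoeff_mul hr hδ h x (star_mem_initial hx) s (Finset.mem_powerset.1 hs), Finset.mul_sum,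
    Complex.ofReal_sum]
  refine Finset.sum_congr rfl fun v _ => ?_
  rw [spinCoeff_star, Complex.mul_conj, Complex.normSq_eq_norm_sq, Complex.ofReal_mul _ (_ ^ 2)]

/-- Sites `m` and `m + 1` are independent of `x`. Their two singly occupied states contribute `κr`
and `κr⁻¹`, normalized by `(1 + κ)²`; the swap terms are off-diagonal and drop out. -/
theorem spinTraceAux_e_mul {κ : ℝ} (hκ : 0 < κ) {n m : ℕ} (h : n < m) {x : TL δ}
    (hx : x ∈ initial δ n) :
    spinTraceAux hr hδ κ (m + 2) (e m * x) =
      (δ * (κ / (1 + κ) ^ 2) : ℝ) * spinTraceAux hr hδ κ m x := by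
  rw [spinTraceAux_apply, sum_powerset_range_succ, sum_powerset_range_succ, spinTraceAux_apply,
    Finset.mul_sum]
  refine Finset.sum_congr rfl fun s hs => ?_
  have h1 := notMem_of_mem_powerset_range le_rfl hs
  have h2 := notMem_of_mem_powerset_range m.le_succ hs
  have hcoeff : ∀ s, spinCoeff hr hδ (e m * x) s s =
      if m ∈ s ∧ m + 1 ∉ s then r * spinCoeff hr hδ x s s
      else if m ∉ s ∧ m + 1 ∈ s then (r : ℂ)⁻¹ * spinCoeff hr hδ x s s else 0 := by
    intro s
    have hsw : ∀ j, n < j → j ∈ swapSites m s → j ∉ s →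
        spinRep hr hδ x (Pi.single s 1) (swapSites m s) = 0 :=
      fun j hj h1 h2 => spinCoeff_eq_zero hr hδ hj hx h1 h2
    rw [spinCoeff, map_mul, Module.End.mul_apply, spinRep_e, spinOp_apply]
    split_ifs with h1 h2
    · rw [hsw (m + 1) (by omega) (by simp [h1.1]) h1.2, add_zero]
      rfl
    · rw [hsw m (by omega) (by simp [h2.2]) h2.1, add_zero]
      rfl
    · rfl
  have h3 : m + 1 ∉ insert m s := by simp [h2]
  simp only [hcoeff]
  rw [spinCoeff_insert hr hδ h hx h1 h1,
    spinCoeff_insert hr hδ (by omega : n < m + 1) hx h2 h2]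
  simp [h1, h2, Finset.card_insert_of_notMem, hδ]
  have h4 : (1 + κ : ℂ) ≠ 0 := by exact_mod_cast (by positivity : 1 + κ ≠ 0)
  have h5 : (r : ℂ) ≠ 0 := by exact_mod_cast hr
  field_simp
  ring

end SpinChain

/-! ### Existence and conclusion. -/

/-- For `δ > 2` and `0 < γ ≤ 1 / 4` there is a strictly positive product trace. -/
theorem exists_isProductTrace (hδ2 : 2 < δ) {γ : ℝ} (hγ0 : 0 < γ) (hγ : γ ≤ 1 / 4) :
    ∃ t : positiveTraces δ, IsProductTrace t.1 (δ * γ) := by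
  obtain ⟨r, hr, hδ⟩ : ∃ r : ℝ, r ≠ 0 ∧ δ = r + r⁻¹ := by
    have hw := Real.sq_sqrt (by nlinarith : (0 : ℝ) ≤ δ ^ 2 - 4)
    have hw0 := Real.sqrt_nonneg (δ ^ 2 - 4)
    set w := √(δ ^ 2 - 4)
    have hpos : 0 < (δ + w) / 2 := by linarith
    refine ⟨(δ + w) / 2, hpos.ne', ?_⟩
    rw [inv_eq_of_mul_eq_one_right (b := (δ - w) / 2) (by linarith)]
    ring
  obtain ⟨κ, hκ, hγκ⟩ : ∃ κ : ℝ, 0 < κ ∧ κ / (1 + κ) ^ 2 = γ := by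
    have hw := Real.sq_sqrt (by linarith : (0 : ℝ) ≤ 1 - 4 * γ)
    have hw0 := Real.sqrt_nonneg (1 - 4 * γ)
    set w := √(1 - 4 * γ)
    have hw1 : 0 < 1 - w := by nlinarith
    -- A root of `κ = γ(1 + κ)²`; here `w < 1` because `γ > 0`.
    refine ⟨(1 + w) / (1 - w), by positivity, ?_⟩
    have h1 : 1 + (1 + w) / (1 - w) = 2 / (1 - w) := by field_simp; ring
    rw [h1]
    field_simp
    linarith
  obtain ⟨T, hT⟩ := exists_linearMap_eventually_eq (spinTraceAux hr hδ κ) fun x => by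
    obtain ⟨n, hn⟩ := exists_mem_initial x
    refine ⟨spinTraceAux hr hδ κ (n + 1) x, ?_⟩
    filter_upwards [eventually_ge_atTop (n + 1)] with m hm
    exact spinTraceAux_eq hr hδ hκ n.lt_succ_self hm hn
  have hTeq : ∀ {n N : ℕ}, n < N → ∀ {x}, x ∈ initial δ n → T x = spinTraceAux hr hδ κ N x := by
    intro n N h x hx
    obtain ⟨M, hM, hNM⟩ := ((hT x).and (eventually_ge_atTop N)).exists
    rw [← hM, spinTraceAux_eq hr hδ hκ h hNM hx]
  have hT1 : T 1 = 1 := by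
    rw [hTeq zero_lt_one (one_mem _), spinTraceAux_one hr hδ hκ]
  have hcomm : ∀ a b, T (a * b) = T (b * a) := by
    intro a b
    obtain ⟨n, hn⟩ := exists_mem_initial a
    obtain ⟨k, hk⟩ := exists_mem_initial b
    have hn' := initial_mono (le_max_left n k) hn
    have hk' := initial_mono (le_max_right n k) hk
    rw [hTeq (Nat.lt_succ_self _) (mul_mem hn' hk'), hTeq (Nat.lt_succ_self _) (mul_mem hk' hn'),
      spinTraceAux_mul_comm hr hδ (Nat.lt_succ_self _) hn' hk']
  have hnonneg : IsNonnegTrace T := by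
    refine ⟨hcomm, fun a => ?_⟩
    obtain ⟨n, hn⟩ := exists_mem_initial a
    refine ⟨_, (hTeq n.lt_succ_self (mul_mem hn (star_mem_initial hn))).trans
      (spinTraceAux_mul_star hr hδ κ n.lt_succ_self hn), ?_⟩
    positivity
  have hprod : IsProductTrace T (δ * γ) := by
    refine ⟨hcomm, fun x => ?_⟩
    obtain ⟨n, hn⟩ := exists_mem_initial x
    filter_upwards [eventually_gt_atTop n] with m hm
    have hmem : e m * x ∈ initial δ (m + 1) :=
      mul_mem (e_mem_initial m.lt_succ_self) (initial_mono (by omega) hn)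
    rw [hcomm, hTeq (by omega : m + 1 < m + 2) hmem, spinTraceAux_e_mul hr hδ hκ hm hn,
      hTeq hm hn, hγκ, Complex.ofReal_mul]
  -- `T(xx*)` is a sum of squares with positive weights, and its vacuum term is `|augmentation δ
  -- x|²` up to a positive factor.
  have haug : ∀ x, T (x * star x) = 0 → augmentation δ x = 0 := by
    intro x hx
    obtain ⟨n, hn⟩ := exists_mem_initial x
    rw [hTeq n.lt_succ_self (mul_mem hn (star_mem_initial hn)),
      spinTraceAux_mul_star hr hδ κ n.lt_succ_self hn, Complex.ofReal_eq_zero,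
      Finset.sum_eq_zero_iff_of_nonneg (fun s _ => by positivity)] at hx
    have h1 := hx ∅ (Finset.empty_mem_powerset _)
    rw [Finset.sum_eq_zero_iff_of_nonneg (fun s _ => by positivity)] at h1
    have h2 := h1 ∅ (Finset.empty_mem_powerset _)
    rw [← spinCoeff_empty hr hδ]
    have h3 : (1 + κ)⁻¹ ^ (n + 1) ≠ 0 := by positivity
    simpa [h3, spinCoeff_empty, (by positivity : 1 + κ ≠ 0)] using h2
  have hτ : (δ * γ : ℂ) ≠ 0 := by
    have : δ * γ ≠ 0 := by positivity
    exact_mod_cast this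
  refine ⟨⟨T, hT1, hcomm, fun a ha => ?_⟩, hprod⟩
  obtain ⟨R, hR, hR0⟩ := hnonneg.nonneg a
  rw [hR, Complex.ofReal_re, Complex.ofReal_im]
  refine ⟨hR0.lt_of_ne ?_, rfl⟩
  rintro rfl
  exact ha (hnonneg.eq_zero_of_null hδ2 hprod hτ haug (hR.trans Complex.ofReal_zero))

end TL

theorem mainTheorem8 (q : ℂ) (hq0 : q ≠ 0) (hq : ∀ k : ℕ, 0 < k → q ^ k ≠ 1)
    (δ : ℝ) (hδ : (δ : ℂ) = q + q⁻¹) (hδ0 : 0 ≤ δ)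
    (γ : ℝ) (hγ0 : 0 < γ) (hγ : γ ≤ 1 / 4) :
    (2 < δ → ∃! t : TL.positiveTraces δ,
      TL.IsExtremal t ∧ (t : TL δ →ₗ[ℂ] ℂ) (TL.e 0) = (δ : ℂ) * (γ : ℂ)) ∧
    ∀ t : TL.positiveTraces δ, TL.IsExtremal t →
      (t : TL δ →ₗ[ℂ] ℂ) (TL.e 0) = (δ : ℂ) * (γ : ℂ) →
      TL.NoClosedInvariantSubspace t := by
  refine ⟨fun hδ2 => ?_, fun t ht _ => ht.noClosedInvariantSubspace⟩
  have hδpos : 0 < δ := by linarith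
  obtain ⟨t, ht⟩ := TL.exists_isProductTrace hδ2 hγ0 hγ
  refine ⟨t, ⟨ht.isExtremal hδpos, by rw [ht.apply_e, t.2.1, mul_one]⟩, ?_⟩
  rintro s ⟨hs, hse⟩
  have hs' := hs.isProductTrace hδpos
  rw [hse] at hs'
  exact Subtype.ext (hs'.eq hδpos.ne' ht (s.2.1.trans t.2.1.symm))
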